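/- Let $V$ be a finite-dimensional real vector space with a symmetric bilinear form $B$, and let $\Delta$ be a basis of $V$ that is a simple system: $B(\alpha,\alpha)=1$ for all $\alpha\in\Delta$, and $B(\alpha,\beta)\in(-\infty,-1]\cup\{-\cos(\pi/k) : k\in\mathbb Z_{\ge 2}\}$ for all distinct $\alpha,\beta\in\Delta$. For $\alpha\in V$ with $B(\alpha,\alpha)\neq 0$ let $s_\alpha(v)=v-2\frac{B(\alpha,v)}{B(\alpha,\alpha)}\alpha$. Let $W$ be the group generated by the $s_\alpha$, $\alpha\in\Delta$, let $\Phi=W(\Delta)$ be the root system, and let $\Phi^+\subseteq\Phi$ be the set of positive roots, i.e. the roots that are nonnegative linear combinations of $\Delta$. Write $|v|_1$ for the sum of the coordinates of $v$ in the basis $\Delta$, put $\hat v=v/|v|_1$ when $|v|_1\ne0$ (which holds for every root), and $\hat A=\{\hat a : a\in A\}$ for $A\subseteq\Phi$. Let $\hat Q=\{v\in V : B(v,v)=0,\ |v|_1=1\}$. Let $E$ be the set of accumulation points of $\hat\Phi$ (the limit roots). For distinct $\rho_1,\rho_2\in\Phi^+$ let $W'=\langle s_{\rho_1},s_{\rho_2}\rangle$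 be the dihedral reflection subgroup they generate and $\Phi'=\{\rho\in\Phi : s_\rho\in W'\}$; the limit roots of $W'$ are the accumulation points of $\hat\Phi'$. Let $E_2$ be the union of the sets of limit roots of $W'$, over all infinite dihedral reflection subgroups $W'$ of this form. **Theorem.** Suppose that $\Phi$ is infinite. Then $$E_2=\bigcup_{\rho_1\ne\rho_2\in\Phi^+} L(\hat\rho_1,\hat\rho_2)\cap\hat Q,$$ where $L(\hat\rho_1,\hat\rho_2)$ is the line through $\hat\rho_1$ and $\hat\rho_2$. Moreover $E_2\subseteq E$ and $E_2$ is dense in $E$, so that $E$ is the closure of $E_2$. -/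

import Mathlib

namespace BasedRoot

noncomputable section

/-- The `B`-reflection associated to `α`,
`v ↦ v - 2 (B(α, v) / B(α, α)) α`. It is only meaningful when `B(α, α) ≠ 0`; with Lean's division by
zero it is the identity when `B(α, α) = 0`, hence always an involution. -/
def reflectionMap {V : Type*} [AddCommGroup V] [Module ℝ V]
    (B : LinearMap.BilinForm ℝ V) (α : V) : V →ₗ[ℝ] V :=
  LinearMap.id - (LinearMap.toSpanSingleton ℝ V α).comp ((2 / B α α) • B α)

theorem reflectionMap_apply {V : Type*} [AddCommGroup V] [Module ℝ V]
    (B : LinearMap.BilinForm ℝ V) (α v : V) :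
    reflectionMap B α v = v - (2 * (B α v / B α α)) • α := by
  simp only [reflectionMap, LinearMap.sub_apply, LinearMap.id_apply, LinearMap.comp_apply,
    LinearMap.smul_apply, LinearMap.toSpanSingleton_apply, smul_eq_mul]
  congr 2
  ring

theorem reflectionMap_involutive {V : Type*} [AddCommGroup V] [Module ℝ V]
    (B : LinearMap.BilinForm ℝ V) (α : V) : Function.Involutive (reflectionMap B α) := by
  intro v
  rcases eq_or_ne (B α α) 0 with h | h
  · simp [reflectionMap_apply, h]
  · simp only [reflectionMap_apply, map_sub, map_smul, div_self h]
    module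

/-- The `B`-reflection `s_α`, as an element of `GL(V)`. -/
def reflection {V : Type*} [AddCommGroup V] [Module ℝ V]
    (B : LinearMap.BilinForm ℝ V) (α : V) : V ≃ₗ[ℝ] V :=
  LinearEquiv.ofInvolutive (reflectionMap B α) (reflectionMap_involutive B α)

/-- The finite family `Δ` is a simple system in `(V, B)`. (Distinct indices automatically carry
distinct vectors, by `diag` and `off_diag`.) -/
structure IsSimpleSystem {ι V : Type*} [Fintype ι] [AddCommGroup V] [Module ℝ V]
    (B : LinearMap.BilinForm ℝ V) (Δ : ι → V) : Prop where
  symm : ∀ u v : V, B u v = B v u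
  pos_indep : ∀ c : ι → ℝ, (∀ i, 0 ≤ c i) → ∑ i, c i • Δ i = 0 → ∀ i, c i = 0
  off_diag : ∀ i j, i ≠ j →
    B (Δ i) (Δ j) ≤ -1 ∨ ∃ k : ℕ, 2 ≤ k ∧ B (Δ i) (Δ j) = -Real.cos (Real.pi / k)
  diag : ∀ i, B (Δ i) (Δ i) = 1

/-- The group `W` generated by the simple reflections. -/
def weylGroup {ι V : Type*} [AddCommGroup V] [Module ℝ V]
    (B : LinearMap.BilinForm ℝ V) (Δ : ι → V) : Subgroup (V ≃ₗ[ℝ] V) :=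
  Subgroup.closure (Set.range fun i => reflection B (Δ i))

/-- The root system `Φ`: the orbit of `Δ` under `W`. -/
def roots {ι V : Type*} [AddCommGroup V] [Module ℝ V]
    (B : LinearMap.BilinForm ℝ V) (Δ : ι → V) : Set V :=
  {v | ∃ w ∈ weylGroup B Δ, ∃ i, w (Δ i) = v}

/-- The cone of nonnegative linear combinations of `Δ`. -/
def cone {ι V : Type*} [Fintype ι] [AddCommGroup V] [Module ℝ V] (Δ : ι → V) : Set V :=
  {v | ∃ c : ι → ℝ, (∀ i, 0 ≤ c i) ∧ ∑ i, c i • Δ i = v}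

/-- The positive roots `Φ⁺ = Φ ∩ cone(Δ)`. -/
def posRoots {ι V : Type*} [Fintype ι] [AddCommGroup V] [Module ℝ V]
    (B : LinearMap.BilinForm ℝ V) (Δ : ι → V) : Set V :=
  roots B Δ ∩ cone Δ

/-- `|v|₁`, the sum of the coordinates of `v` in the basis `Δ` (not a norm). -/
def coordSum {ι V : Type*} [Fintype ι] [AddCommGroup V] [Module ℝ V]
    (Δ : Module.Basis ι ℝ V) (v : V) : ℝ :=
  ∑ i, Δ.repr v i

/-- The normalization `v̂ = v / |v|₁`, meaningful for `|v|₁ ≠ 0`, in particular for all roots. -/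
def normalizeVec {ι V : Type*} [Fintype ι] [AddCommGroup V] [Module ℝ V]
    (Δ : Module.Basis ι ℝ V) (v : V) : V :=
  (coordSum Δ v)⁻¹ • v

/-- The set of accumulation points of the normalizations of the elements of a set `A` of roots. -/
def limitSet {ι V : Type*} [Fintype ι] [NormedAddCommGroup V] [NormedSpace ℝ V]
    (Δ : Module.Basis ι ℝ V) (A : Set V) : Set V :=
  derivedSet (normalizeVec Δ '' A)

/-- The set `E` of limit roots. -/
def limitRoots {ι V : Type*} [Fintype ι] [NormedAddCommGroup V] [NormedSpace ℝ V]
    (B : LinearMap.BilinForm ℝ V) (Δ : Module.Basis ι ℝ V) : Set V :=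
  limitSet Δ (roots B Δ)

/-- The normalized isotropic cone `Q̂ = {v | B(v, v) = 0 and |v|₁ = 1}`. -/
def normalizedIsotropicCone {ι V : Type*} [Fintype ι] [AddCommGroup V] [Module ℝ V]
    (B : LinearMap.BilinForm ℝ V) (Δ : Module.Basis ι ℝ V) : Set V :=
  {v | B v v = 0 ∧ coordSum Δ v = 1}

/-- The subgroup generated by the two reflections `s_ρ₁`, `s_ρ₂`. -/
def dihedralSubgroup {V : Type*} [AddCommGroup V] [Module ℝ V]
    (B : LinearMap.BilinForm ℝ V) (ρ₁ ρ₂ : V) : Subgroup (V ≃ₗ[ℝ] V) :=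
  Subgroup.closure {reflection B ρ₁, reflection B ρ₂}

/-- The roots `Φ' = {ρ ∈ Φ | s_ρ ∈ W'}` of a subgroup `W'`. -/
def subsystem {ι V : Type*} [AddCommGroup V] [Module ℝ V]
    (B : LinearMap.BilinForm ℝ V) (Δ : ι → V) (W' : Subgroup (V ≃ₗ[ℝ] V)) : Set V :=
  {ρ | ρ ∈ roots B Δ ∧ reflection B ρ ∈ W'}

/-- The set `E₂`: the union, over all infinite dihedral reflection subgroups
`W' = ⟨s_ρ₁, s_ρ₂⟩` with `ρ₁ ≠ ρ₂` positive roots, of the limit roots of `W'`. -/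
def dihedralLimitRoots {ι V : Type*} [Fintype ι] [NormedAddCommGroup V] [NormedSpace ℝ V]
    (B : LinearMap.BilinForm ℝ V) (Δ : Module.Basis ι ℝ V) : Set V :=
  {x | ∃ ρ₁ ∈ posRoots B Δ, ∃ ρ₂ ∈ posRoots B Δ, ρ₁ ≠ ρ₂ ∧
    (dihedralSubgroup B ρ₁ ρ₂ : Set (V ≃ₗ[ℝ] V)).Infinite ∧
    x ∈ limitSet Δ (subsystem B Δ (dihedralSubgroup B ρ₁ ρ₂))}

/-- The union, over all pairs of distinct positive roots, of the intersection of `Q̂` with the line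
through the two normalized roots. -/
def isotropicLinePoints {ι V : Type*} [Fintype ι] [AddCommGroup V] [Module ℝ V]
    (B : LinearMap.BilinForm ℝ V) (Δ : Module.Basis ι ℝ V) : Set V :=
  {x | ∃ ρ₁ ∈ posRoots B Δ, ∃ ρ₂ ∈ posRoots B Δ, ρ₁ ≠ ρ₂ ∧
    x ∈ (affineSpan ℝ {normalizeVec Δ ρ₁, normalizeVec Δ ρ₂} : Set V) ∩ normalizedIsotropicCone B Δ}

end

end BasedRoot

namespace BasedRoot

/-! ### Reflections, words in the simple reflections, and length -/

section Algebra

variable {ι V : Type*} [AddCommGroup V] [Module ℝ V]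
  {B : LinearMap.BilinForm ℝ V}

/-! Every root is positive or negative (`repr_nonneg_of_len_le`), and only finitely many positive
roots have bounded height (`finite_posRoots_height_le`). Since B(ρ̂, ρ̂) is the inverse square of
the height, limit roots are isotropic (`limitRoots_subset`), while normalized roots never are.

Limit roots of ⟨s_ρ, s_σ⟩ lie in the plane of ρ and σ, hence on the line through ρ̂ and σ̂.
Conversely, an isotropic point on that line forces |B(ρ, σ)| ≥ 1, so the orbit of ρ under s_ρ s_σ is
infinite and compactness yields one limit root. The line has at most two isotropic points, and when
there are two, s_ρ exchanges them up to scale, so both are limit roots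
(`isotropicLinePoints_subset`).

For density let x be a limit root. If B(α, x) ≠ 0 for some simple α, then x is a simple zero of B on
the line through x in direction α, so lines through α and normalized roots near x meet the quadric
near x (`mem_closure_of_bilin_ne_zero`). Otherwise x is a nonnegative vector of the radical, and B
is positive semidefinite on the span of its support, as for affine types. There B takes finitely
many values on pairs of a root and a simple root (`IsConeRadical.bilin_mem_bilinValues`). By
pigeonhole, roots ρ with ρ̂ arbitrarily near x share all these values with a fixed root η. Then ρ −
η is in the radical, and its normalization tends to x. -/

theorem reflection_apply_of_unit {α : V} (h : B α α = 1) (v : V) :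
    reflection B α v = v - (2 * B α v) • α := by
  change reflectionMap B α v = _
  rw [reflectionMap_apply, h, div_one]

theorem reflection_mul_self (α : V) : reflection B α * reflection B α = 1 := by
  ext v
  exact reflectionMap_involutive B α v

theorem reflection_reflection (α v : V) : reflection B α (reflection B α v) = v :=
  reflectionMap_involutive B α v

theorem reflection_inv (α : V) : (reflection B α)⁻¹ = reflection B α :=
  inv_eq_of_mul_eq_one_left (reflection_mul_self α)

theorem reflection_self {α : V} (h : B α α = 1) : reflection B α α = -α := by
  rw [reflection_apply_of_unit h, h]
  module

theorem reflection_isometry (hB : ∀ u v, B u v = B v u) {α : V} (h : B α α = 1) (u v : V) :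
    B (reflection B α u) (reflection B α v) = B u v := by
  simp only [reflection_apply_of_unit h, map_sub, map_smul, LinearMap.sub_apply,
    LinearMap.smul_apply, smul_eq_mul, h, hB u α]
  ring

theorem reflection_map_of_isometry (w : V ≃ₗ[ℝ] V) (hw : ∀ u v, B (w u) (w v) = B u v) {α : V}
    (h : B α α = 1) : reflection B (w α) = w * reflection B α * w⁻¹ := by
  ext v
  have h1 : B (w α) (w α) = 1 := by rw [hw, h]
  have h2 : B (w α) v = B α (w⁻¹ v) := by
    rw [← hw α]
    exact congrArg (B (w α)) (w.apply_symm_apply v).symm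
  have h3 : w (w⁻¹ v) = v := w.apply_symm_apply v
  rw [LinearEquiv.mul_apply, LinearEquiv.mul_apply, reflection_apply_of_unit h1,
    reflection_apply_of_unit h, map_sub, map_smul, h2, h3]

/-- The product of the simple reflections indexed by a word. -/
noncomputable def wordProd (B : LinearMap.BilinForm ℝ V) (Δ : ι → V) (L : List ι) : V ≃ₗ[ℝ] V :=
  (L.map fun i => reflection B (Δ i)).prod

theorem wordProd_append (Δ : ι → V) (L M : List ι) :
    wordProd B Δ (L ++ M) = wordProd B Δ L * wordProd B Δ M := by
  simp [wordProd]

theorem reflection_mem_weylGroup (Δ : ι → V) (i : ι) : reflection B (Δ i) ∈ weylGroup B Δ :=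
  Subgroup.subset_closure ⟨i, rfl⟩

theorem wordProd_mem (Δ : ι → V) (L : List ι) : wordProd B Δ L ∈ weylGroup B Δ := by
  apply Subgroup.list_prod_mem
  intro x hx
  obtain ⟨i, -, rfl⟩ := List.mem_map.1 hx
  exact reflection_mem_weylGroup Δ i

theorem exists_wordProd {Δ : ι → V} {w : V ≃ₗ[ℝ] V} (hw : w ∈ weylGroup B Δ) :
    ∃ L, wordProd B Δ L = w := by
  induction hw using Subgroup.closure_induction with
  | mem x hx =>
    obtain ⟨i, rfl⟩ := hx
    exact ⟨[i], by simp [wordProd]⟩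
  | one => exact ⟨[], rfl⟩
  | mul x y _ _ hx hy =>
    obtain ⟨L, rfl⟩ := hx
    obtain ⟨M, rfl⟩ := hy
    exact ⟨L ++ M, wordProd_append Δ L M⟩
  | inv x _ hx =>
    obtain ⟨L, rfl⟩ := hx
    refine ⟨L.reverse, ?_⟩
    simp only [wordProd, List.prod_inv_reverse, List.map_map, List.map_reverse]
    congr 2

/-- The word length on the group generated by the simple reflections. -/
noncomputable def len (B : LinearMap.BilinForm ℝ V) (Δ : ι → V) (w : V ≃ₗ[ℝ] V) : ℕ :=
  sInf {n | ∃ L, L.length = n ∧ wordProd B Δ L = w}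

theorem len_wordProd_le (Δ : ι → V) (L : List ι) : len B Δ (wordProd B Δ L) ≤ L.length :=
  Nat.sInf_le ⟨L, rfl, rfl⟩

theorem exists_reduced_word {Δ : ι → V} {w : V ≃ₗ[ℝ] V} (hw : w ∈ weylGroup B Δ) :
    ∃ L, L.length = len B Δ w ∧ wordProd B Δ L = w := by
  obtain ⟨L, hL⟩ := exists_wordProd hw
  exact Nat.sInf_mem (s := {n | ∃ L, L.length = n ∧ wordProd B Δ L = w}) ⟨_, L, rfl, hL⟩

theorem len_mul_le {Δ : ι → V} {w w' : V ≃ₗ[ℝ] V} (hw : w ∈ weylGroup B Δ)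
    (hw' : w' ∈ weylGroup B Δ) : len B Δ (w * w') ≤ len B Δ w + len B Δ w' := by
  obtain ⟨L, hL, rfl⟩ := exists_reduced_word hw
  obtain ⟨M, hM, rfl⟩ := exists_reduced_word hw'
  rw [← wordProd_append, ← hL, ← hM, ← List.length_append]
  exact len_wordProd_le Δ _

theorem len_reflection_le (Δ : ι → V) (i : ι) : len B Δ (reflection B (Δ i)) ≤ 1 := by
  simpa [wordProd] using len_wordProd_le (B := B) Δ [i]

theorem len_one (Δ : ι → V) : len B Δ 1 = 0 :=
  Nat.le_zero.1 (len_wordProd_le (B := B) Δ [])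

theorem exists_len_mul_reflection_lt {Δ : ι → V} {w : V ≃ₗ[ℝ] V} (hw : w ∈ weylGroup B Δ)
    (h1 : w ≠ 1) : ∃ i, len B Δ (w * reflection B (Δ i)) + 1 ≤ len B Δ w := by
  obtain ⟨L, hL, rfl⟩ := exists_reduced_word hw
  rcases List.eq_nil_or_concat L with rfl | ⟨M, i, rfl⟩
  · exact absurd rfl h1
  · refine ⟨i, ?_⟩
    rw [← hL]
    have : wordProd B Δ (M ++ [i]) * reflection B (Δ i) = wordProd B Δ M := by
      rw [wordProd_append, mul_assoc]
      simp [wordProd, reflection_mul_self]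
    rw [List.concat_eq_append, this, List.length_append]
    exact Nat.add_le_add_right (len_wordProd_le Δ M) 1

theorem weylGroup_isometry {Δ : ι → V} (hB : ∀ u v, B u v = B v u) (hd : ∀ i, B (Δ i) (Δ i) = 1)
    {w : V ≃ₗ[ℝ] V} (hw : w ∈ weylGroup B Δ) (u v : V) : B (w u) (w v) = B u v := by
  obtain ⟨L, rfl⟩ := exists_wordProd hw
  induction L with
  | nil => rfl
  | cons i L ih =>
    have : wordProd B Δ (i :: L) = reflection B (Δ i) * wordProd B Δ L := by simp [wordProd]
    rw [this, LinearEquiv.mul_apply, LinearEquiv.mul_apply, reflection_isometry hB (hd i),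
      ih (wordProd_mem Δ L)]

/-! ### Alternating words in two simple reflections -/

/-- The alternating product of `k` factors ending in `s_t`. -/
noncomputable def alt (B : LinearMap.BilinForm ℝ V) (Δ : ι → V) (s t : ι) : ℕ → (V ≃ₗ[ℝ] V)
  | 0 => 1
  | k + 1 => reflection B (Δ (if Even k then t else s)) * alt B Δ s t k

theorem alt_mem (Δ : ι → V) (s t : ι) (k : ℕ) : alt B Δ s t k ∈ weylGroup B Δ := by
  induction k with
  | zero => exact one_mem _
  | succ k ih => exact mul_mem (reflection_mem_weylGroup Δ _) ih

theorem len_alt_le (Δ : ι → V) (s t : ι) (k : ℕ) : len B Δ (alt B Δ s t k) ≤ k := by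
  induction k with
  | zero => exact (len_one Δ).le
  | succ k ih =>
    refine (len_mul_le (reflection_mem_weylGroup Δ _) (alt_mem Δ s t k)).trans ?_
    have := len_reflection_le (B := B) Δ (if Even k then t else s)
    omega

/-- The sequence `0, 1, 2a, …` with `U_{k+2} = 2 a U_{k+1} - U_k`. -/
noncomputable def chebSeq (a : ℝ) : ℕ → ℝ
  | 0 => 0
  | 1 => 1
  | k + 2 => 2 * a * chebSeq a (k + 1) - chebSeq a k

theorem chebSeq_add_one_le {a : ℝ} (ha : 1 ≤ a) (k : ℕ) :
    0 ≤ chebSeq a k ∧ chebSeq a k + 1 ≤ chebSeq a (k + 1) := by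
  induction k with
  | zero => simp [chebSeq]
  | succ k ih =>
    obtain ⟨h0, h1⟩ := ih
    refine ⟨by linarith, ?_⟩
    simp only [chebSeq]
    nlinarith

theorem chebSeq_cos_mul_sin (θ : ℝ) (k : ℕ) :
    chebSeq (Real.cos θ) k * Real.sin θ = Real.sin (k * θ) := by
  induction k using Nat.twoStepInduction with
  | zero => simp [chebSeq]
  | one => simp [chebSeq]
  | more k h0 h1 =>
    simp only [chebSeq]
    have e1 : ((k + 2 : ℕ) : ℝ) * θ = ((k + 1 : ℕ) : ℝ) * θ + θ := by push_cast; ring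
    have e2 : (k : ℝ) * θ = ((k + 1 : ℕ) : ℝ) * θ - θ := by push_cast; ring
    rw [e2, Real.sin_sub] at h0
    rw [e1, Real.sin_add]
    linear_combination 2 * Real.cos θ * h1 - h0

/-- Here U_k sin θ = sin kθ with θ = π/m, and kθ stays in [0, π] for k ≤ m. -/
theorem chebSeq_cos_pi_div {m : ℕ} (hm : 2 ≤ m) :
    chebSeq (Real.cos (Real.pi / m)) m = 0 ∧ chebSeq (Real.cos (Real.pi / m)) (m - 1) = 1 ∧
      ∀ k ≤ m, 0 ≤ chebSeq (Real.cos (Real.pi / m)) k := by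
  have hm' : (2 : ℝ) ≤ m := by exact_mod_cast hm
  have hpos : 0 < Real.pi / m := by positivity
  have hlt : Real.pi / m < Real.pi := by
    rw [div_lt_iff₀ (by linarith)]
    nlinarith [Real.pi_pos]
  have hs : 0 < Real.sin (Real.pi / m) := Real.sin_pos_of_pos_of_lt_pi hpos hlt
  have hmm : (m : ℝ) * (Real.pi / m) = Real.pi := by field_simp
  refine ⟨?_, ?_, fun k hk => ?_⟩
  · have := chebSeq_cos_mul_sin (Real.pi / m) m
    rw [hmm, Real.sin_pi] at this
    exact (mul_eq_zero.1 this).resolve_right hs.ne'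
  · have := chebSeq_cos_mul_sin (Real.pi / m) (m - 1)
    rw [Nat.cast_sub (by omega), sub_mul, hmm, Nat.cast_one, one_mul, Real.sin_pi_sub] at this
    exact mul_right_cancel₀ hs.ne' (by rw [this, one_mul])
  · have := chebSeq_cos_mul_sin (Real.pi / m) k
    have h2 : 0 ≤ Real.sin (k * (Real.pi / m)) := by
      apply Real.sin_nonneg_of_nonneg_of_le_pi (by positivity)
      calc (k : ℝ) * (Real.pi / m) ≤ m * (Real.pi / m) := by gcongr
        _ = Real.pi := hmm
    rw [← this] at h2
    exact nonneg_of_mul_nonneg_left h2 hs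

theorem alt_apply {Δ : ι → V} (hB : ∀ u v, B u v = B v u) (hd : ∀ i, B (Δ i) (Δ i) = 1)
    (s t : ι) (k : ℕ) :
    alt B Δ s t k (Δ s) =
      chebSeq (-B (Δ s) (Δ t)) (k + 1) • Δ (if Even k then s else t) +
        chebSeq (-B (Δ s) (Δ t)) k • Δ (if Even k then t else s) := by
  induction k with
  | zero => simp [alt, chebSeq]
  | succ k ih =>
    rw [alt, LinearEquiv.mul_apply, ih, reflection_apply_of_unit (hd _)]
    by_cases hk : Even k
    · have hk' : ¬ Even (k + 1) := by rwa [Nat.even_add_one, not_not]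
      simp only [hk, hk', if_true, if_false, map_add, map_smul, hd, hB (Δ t) (Δ s), smul_eq_mul,
        chebSeq]
      module
    · have hk' : Even (k + 1) := by rwa [Nat.even_add_one]
      simp only [hk, hk', if_true, if_false, map_add, map_smul, hd, smul_eq_mul, chebSeq]
      module

/-- The hypotheses say that the product of `m` letters carries `Δ s` to the simple root of the next
letter. Conjugating `s_s` therefore gives that letter: this is the braid relation of order `m + 1`.
-/
theorem alt_mul_reflection {Δ : ι → V} (hB : ∀ u v, B u v = B v u)
    (hd : ∀ i, B (Δ i) (Δ i) = 1) {s t : ι} {m : ℕ}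
    (h0 : chebSeq (-B (Δ s) (Δ t)) (m + 1) = 0) (h1 : chebSeq (-B (Δ s) (Δ t)) m = 1) :
    alt B Δ s t (m + 1) * reflection B (Δ s) = alt B Δ s t m := by
  have h2 := alt_apply hB hd s t m
  rw [h0, h1, zero_smul, zero_add, one_smul] at h2
  have h3 := reflection_map_of_isometry (alt B Δ s t m)
    (weylGroup_isometry hB hd (alt_mem Δ s t m)) (hd s)
  rw [h2] at h3
  rw [alt, h3]
  have : (alt B Δ s t m * reflection B (Δ s) * (alt B Δ s t m)⁻¹ * alt B Δ s t m *
      reflection B (Δ s)) = alt B Δ s t m * (reflection B (Δ s) * reflection B (Δ s)) := by group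
  rw [this, reflection_mul_self, mul_one]

theorem len_alt_mul_reflection_le {Δ : ι → V} (hB : ∀ u v, B u v = B v u)
    (hd : ∀ i, B (Δ i) (Δ i) = 1) {s t : ι} {m : ℕ}
    (h0 : chebSeq (-B (Δ s) (Δ t)) (m + 1) = 0) (h1 : chebSeq (-B (Δ s) (Δ t)) m = 1) (k : ℕ) :
    len B Δ (alt B Δ s t (m + 1 + k) * reflection B (Δ s)) ≤ m + k := by
  induction k with
  | zero =>
    rw [add_zero, alt_mul_reflection hB hd h0 h1]
    exact len_alt_le Δ s t m
  | succ k ih =>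
    rw [← add_assoc, alt, mul_assoc]
    refine (len_mul_le (reflection_mem_weylGroup Δ _)
      (mul_mem (alt_mem Δ s t _) (reflection_mem_weylGroup Δ _))).trans ?_
    have := len_reflection_le (B := B) Δ (if Even (m + 1 + k) then t else s)
    omega

theorem roots_induction {Δ : ι → V} {P : V → Prop} (h0 : ∀ i, P (Δ i))
    (h1 : ∀ i v, P v → P (reflection B (Δ i) v)) {ρ : V} (hρ : ρ ∈ roots B Δ) : P ρ := by
  obtain ⟨w, hw, i, rfl⟩ := hρ
  obtain ⟨L, rfl⟩ := exists_wordProd hw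
  clear hw
  induction L with
  | nil => exact h0 i
  | cons j L ih =>
    have : wordProd B Δ (j :: L) = reflection B (Δ j) * wordProd B Δ L := by simp [wordProd]
    rw [this]
    exact h1 j _ ih

theorem simple_mem_roots (Δ : ι → V) (i : ι) : Δ i ∈ roots B Δ := ⟨1, one_mem _, i, rfl⟩

theorem apply_mem_roots {Δ : ι → V} {w : V ≃ₗ[ℝ] V} (hw : w ∈ weylGroup B Δ) {ρ : V} (hρ : ρ ∈ roots B Δ) :
    w ρ ∈ roots B Δ := by
  obtain ⟨w', hw', i, rfl⟩ := hρ
  exact ⟨w * w', mul_mem hw hw', i, rfl⟩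

end Algebra

/-! ### Positive and negative roots, and the height form -/

section Positivity

variable {ι V : Type*} [Fintype ι] [AddCommGroup V] [Module ℝ V]
  {B : LinearMap.BilinForm ℝ V} {Δ : Module.Basis ι ℝ V}

/-- Factor `w` as `v` times an alternating word in `s` and a right descent `t`, with `v` shorter
than `w` and without descent at `s` or `t`. By induction `v` keeps both simple roots positive, and
the alternating word sends `Δ s` to a nonnegative combination of them. -/
theorem repr_nonneg_of_len_le (hΔ : IsSimpleSystem B Δ) (n : ℕ) :
    ∀ w ∈ weylGroup B Δ, len B Δ w = n → ∀ s, n ≤ len B Δ (w * reflection B (Δ s)) →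
      ∀ j, 0 ≤ Δ.repr (w (Δ s)) j := by
  classical
  induction n using Nat.strong_induction_on with
  | _ n ih =>
  intro w hw hn s hs j
  by_cases h1 : w = 1
  · subst h1
    simp only [LinearEquiv.coe_one, id_eq, Module.Basis.repr_self]
    exact Finsupp.single_nonneg.2 zero_le_one j
  obtain ⟨t, ht⟩ := exists_len_mul_reflection_lt hw h1
  have hst : s ≠ t := by
    rintro rfl
    omega
  -- The longest alternating suffix that can be split off with total length at most `n`.
  let P : ℕ → Prop := fun k => ∃ v ∈ weylGroup B Δ, w = v * alt B Δ s t k ∧ len B Δ v + k ≤ n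
  have hP1 : P 1 := by
    refine ⟨w * reflection B (Δ t), mul_mem hw (reflection_mem_weylGroup Δ t), ?_, by omega⟩
    simp [alt, mul_assoc, reflection_mul_self]
  have hPn : ∀ k, P k → k ≤ n := by
    rintro k ⟨v, -, -, h⟩
    omega
  set k := Nat.findGreatest P n with hk
  have hPk : P k := Nat.findGreatest_spec (hPn 1 hP1) hP1
  have hk1 : 1 ≤ k := Nat.le_findGreatest (hPn 1 hP1) hP1
  have hPk1 : ¬ P (k + 1) := fun h =>
    absurd (Nat.le_findGreatest (hPn _ h) h) (by omega)
  obtain ⟨v, hv, hwv, hlen⟩ := hPk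
  have hbound : ∀ r, (r = s ∨ r = t) → len B Δ v ≤ len B Δ (v * reflection B (Δ r)) := by
    intro r hr
    by_contra! hlt
    -- If `r` is the next letter, a descent at `r` would lengthen the suffix. Otherwise `r` is its
    -- leftmost letter, and absorbing it into `v` writes `w` with fewer than `n` letters.
    by_cases hre : r = if Even k then t else s
    · apply hPk1
      refine ⟨v * reflection B (Δ r), mul_mem hv (reflection_mem_weylGroup Δ r), ?_, by omega⟩
      rw [alt, ← hre, hwv, mul_assoc, ← mul_assoc (reflection B (Δ r)), reflection_mul_self,
        one_mul]
    · obtain ⟨l, hl⟩ : ∃ l, k = l + 1 := ⟨k - 1, by omega⟩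
      have hrl : r = if Even l then t else s := by
        rw [hl] at hre
        by_cases hE : Even l <;>
          simp only [Nat.even_add_one, hE, not_true, not_false_iff, if_true, if_false] at hre ⊢ <;>
          tauto
      have : w = (v * reflection B (Δ r)) * alt B Δ s t l := by
        rw [hwv, hl, alt, ← hrl, mul_assoc]
      have h2 := len_mul_le (mul_mem hv (reflection_mem_weylGroup Δ r)) (alt_mem (B := B) Δ s t l)
      rw [← this, hn] at h2
      have := len_alt_le (B := B) Δ s t l
      omega
  have hvs : ∀ j, 0 ≤ Δ.repr (v (Δ s)) j :=
    ih _ (by omega) v hv rfl s (hbound s (Or.inl rfl))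
  have hvt : ∀ j, 0 ≤ Δ.repr (v (Δ t)) j :=
    ih _ (by omega) v hv rfl t (hbound t (Or.inr rfl))
  have hU : 0 ≤ chebSeq (-B (Δ s) (Δ t)) (k + 1) ∧ 0 ≤ chebSeq (-B (Δ s) (Δ t)) k := by
    rcases hΔ.off_diag s t hst with h | ⟨m, hm, h⟩
    · exact ⟨(chebSeq_add_one_le (by linarith) _).1, (chebSeq_add_one_le (by linarith) _).1⟩
    · have ha : -B (Δ s) (Δ t) = Real.cos (Real.pi / m) := by rw [h, neg_neg]
      obtain ⟨u0, u1, u2⟩ := chebSeq_cos_pi_div hm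
      rw [← ha] at u0 u1 u2
      rcases lt_or_ge k m with hkm | hkm
      · exact ⟨u2 _ hkm, u2 _ hkm.le⟩
      -- A suffix of at least `m` letters would make `w * s_s` shorter than `w`, against `hs`.
      · exfalso
        obtain ⟨l, hl⟩ : ∃ l, k = m - 1 + 1 + l := ⟨k - m, by omega⟩
        have h3 := len_alt_mul_reflection_le hΔ.symm hΔ.diag (s := s) (t := t) (m := m - 1)
          (by rwa [Nat.sub_add_cancel (by omega)]) u1 l
        rw [← hl] at h3
        have h4 := len_mul_le hv (mul_mem (alt_mem (B := B) Δ s t k)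
          (reflection_mem_weylGroup (B := B) Δ s))
        rw [← mul_assoc, ← hwv] at h4
        omega
  rw [hwv, LinearEquiv.mul_apply, alt_apply hΔ.symm hΔ.diag, map_add, map_smul, map_smul, map_add,
    map_smul, map_smul, Finsupp.add_apply, Finsupp.smul_apply, Finsupp.smul_apply, smul_eq_mul,
    smul_eq_mul]
  refine add_nonneg (mul_nonneg hU.1 ?_) (mul_nonneg hU.2 ?_)
  · split_ifs
    exacts [hvs j, hvt j]
  · split_ifs
    exacts [hvt j, hvs j]

theorem repr_apply_simple_nonneg_or_nonpos (hΔ : IsSimpleSystem B Δ) {w : V ≃ₗ[ℝ] V}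
    (hw : w ∈ weylGroup B Δ) (i : ι) :
    (∀ j, 0 ≤ Δ.repr (w (Δ i)) j) ∨
      len B Δ (w * reflection B (Δ i)) < len B Δ w ∧ ∀ j, Δ.repr (w (Δ i)) j ≤ 0 := by
  rcases le_or_gt (len B Δ w) (len B Δ (w * reflection B (Δ i))) with h | h
  · exact Or.inl (repr_nonneg_of_len_le hΔ _ w hw rfl i h)
  · refine Or.inr ⟨h, fun j => ?_⟩
    have h2 := repr_nonneg_of_len_le hΔ _ (w * reflection B (Δ i))
      (mul_mem hw (reflection_mem_weylGroup _ i)) rfl i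
      (by rw [mul_assoc, reflection_mul_self, mul_one]; exact h.le) j
    rw [LinearEquiv.mul_apply, reflection_self (hΔ.diag i), map_neg, map_neg,
      Finsupp.neg_apply] at h2
    linarith

theorem root_unit (hΔ : IsSimpleSystem B Δ) {ρ : V} (hρ : ρ ∈ roots B Δ) : B ρ ρ = 1 := by
  obtain ⟨w, hw, i, rfl⟩ := hρ
  rw [weylGroup_isometry hΔ.symm hΔ.diag hw, hΔ.diag]

theorem root_ne_zero (hΔ : IsSimpleSystem B Δ) {ρ : V} (hρ : ρ ∈ roots B Δ) : ρ ≠ 0 := by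
  rintro rfl
  simpa using root_unit hΔ hρ

theorem reflection_root_mem (hΔ : IsSimpleSystem B Δ) {ρ : V} (hρ : ρ ∈ roots B Δ) :
    reflection B ρ ∈ weylGroup B Δ := by
  obtain ⟨w, hw, i, rfl⟩ := hρ
  rw [reflection_map_of_isometry w (weylGroup_isometry hΔ.symm hΔ.diag hw) (hΔ.diag i)]
  exact mul_mem (mul_mem hw (reflection_mem_weylGroup _ i)) (inv_mem hw)

theorem neg_mem_roots (hΔ : IsSimpleSystem B Δ) {ρ : V} (hρ : ρ ∈ roots B Δ) :
    -ρ ∈ roots B Δ := by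
  rw [← reflection_self (root_unit hΔ hρ)]
  exact apply_mem_roots (reflection_root_mem hΔ hρ) hρ

theorem mem_cone_iff {v : V} : v ∈ cone Δ ↔ ∀ j, 0 ≤ Δ.repr v j := by
  constructor
  · rintro ⟨c, hc, rfl⟩ j
    rw [Δ.repr_sum_self]
    exact hc j
  · exact fun h => ⟨fun j => Δ.repr v j, h, Δ.sum_repr v⟩

theorem mem_or_neg_mem_posRoots (hΔ : IsSimpleSystem B Δ) {ρ : V} (hρ : ρ ∈ roots B Δ) :
    ρ ∈ posRoots B Δ ∨ -ρ ∈ posRoots B Δ := by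
  have hneg := neg_mem_roots hΔ hρ
  obtain ⟨w, hw, i, h⟩ := id hρ
  rcases repr_apply_simple_nonneg_or_nonpos hΔ hw i with h1 | ⟨-, h1⟩
  · exact Or.inl ⟨hρ, mem_cone_iff.2 (h ▸ h1)⟩
  · refine Or.inr ⟨hneg, mem_cone_iff.2 fun j => ?_⟩
    rw [← h, map_neg, Finsupp.neg_apply]
    linarith [h1 j]

theorem simple_mem_posRoots (i : ι) : Δ i ∈ posRoots B Δ := by
  refine ⟨simple_mem_roots _ i, mem_cone_iff.2 fun j => ?_⟩
  rw [Module.Basis.repr_self]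
  exact Finsupp.single_nonneg.2 zero_le_one j

theorem eq_zero_of_mem_cone_of_neg_mem_cone {v : V} (h : v ∈ cone Δ) (h' : -v ∈ cone Δ) :
    v = 0 := by
  rw [mem_cone_iff] at h h'
  apply Δ.repr.injective
  ext j
  have := h' j
  rw [map_neg, Finsupp.neg_apply] at this
  rw [map_zero, Finsupp.zero_apply]
  linarith [h j]

/-- A nontrivial element has a right descent, and it sends that simple root to a negative root. -/
theorem eq_one_of_forall_mem_cone (hΔ : IsSimpleSystem B Δ) {w : V ≃ₗ[ℝ] V}
    (hw : w ∈ weylGroup B Δ) (h : ∀ i, w (Δ i) ∈ cone Δ) : w = 1 := by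
  by_contra h1
  obtain ⟨i, hi⟩ := exists_len_mul_reflection_lt hw h1
  have h2 := repr_nonneg_of_len_le hΔ _ (w * reflection B (Δ i))
    (mul_mem hw (reflection_mem_weylGroup _ i)) rfl i
    (by rw [mul_assoc, reflection_mul_self, mul_one]; omega)
  rw [← mem_cone_iff, LinearEquiv.mul_apply, reflection_self (hΔ.diag i), map_neg] at h2
  exact root_ne_zero hΔ (apply_mem_roots hw (simple_mem_roots _ i))
    (eq_zero_of_mem_cone_of_neg_mem_cone (h i) h2)

/-- `|·|₁` as a linear form. -/
noncomputable def height (Δ : Module.Basis ι ℝ V) : V →ₗ[ℝ] ℝ := ∑ i, Δ.coord i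

theorem height_apply (v : V) : height Δ v = ∑ i, Δ.repr v i := by
  simp [height]

theorem coordSum_eq_height (v : V) : coordSum Δ v = height Δ v := (height_apply v).symm

theorem height_simple (i : ι) : height Δ (Δ i) = 1 := by
  classical
  rw [height_apply]
  simp [Finsupp.single_apply]

theorem height_nonneg_of_mem_cone {v : V} (h : v ∈ cone Δ) : 0 ≤ height Δ v := by
  rw [height_apply]
  exact Finset.sum_nonneg fun i _ => mem_cone_iff.1 h i

theorem eq_zero_of_height_eq_zero {v : V} (h : v ∈ cone Δ) (h0 : height Δ v = 0) : v = 0 := by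
  rw [height_apply, Finset.sum_eq_zero_iff_of_nonneg fun i _ => mem_cone_iff.1 h i] at h0
  apply Δ.repr.injective
  ext j
  simpa using h0 j (Finset.mem_univ j)

theorem height_pos (hΔ : IsSimpleSystem B Δ) {ρ : V} (hρ : ρ ∈ posRoots B Δ) :
    0 < height Δ ρ :=
  (height_nonneg_of_mem_cone hρ.2).lt_of_ne fun h =>
    root_ne_zero hΔ hρ.1 (eq_zero_of_height_eq_zero hρ.2 h.symm)

theorem mem_posRoots_of_height_pos (hΔ : IsSimpleSystem B Δ) {ρ : V} (hρ : ρ ∈ roots B Δ)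
    (h : 0 < height Δ ρ) : ρ ∈ posRoots B Δ := by
  refine (mem_or_neg_mem_posRoots hΔ hρ).resolve_right fun h' => ?_
  have := height_pos hΔ h'
  rw [map_neg] at this
  linarith

theorem height_ne_zero (hΔ : IsSimpleSystem B Δ) {ρ : V} (hρ : ρ ∈ roots B Δ) :
    height Δ ρ ≠ 0 := by
  rcases mem_or_neg_mem_posRoots hΔ hρ with h | h
  · exact (height_pos hΔ h).ne'
  · have := (height_pos hΔ h).ne'
    rwa [map_neg, neg_ne_zero] at this

theorem eq_of_smul_eq (hΔ : IsSimpleSystem B Δ) {ρ σ : V} (hρ : ρ ∈ posRoots B Δ)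
    (hσ : σ ∈ posRoots B Δ) {c : ℝ} (h : ρ = c • σ) : ρ = σ := by
  have h1 := root_unit hΔ hρ.1
  have h3 := height_pos hΔ hρ
  have h4 := height_pos hΔ hσ
  rw [h] at h1 h3
  simp only [map_smul, LinearMap.smul_apply, smul_eq_mul, root_unit hΔ hσ.1] at h1 h3
  have hc : 0 < c := pos_of_mul_pos_left h3 h4.le
  have : c = 1 := by nlinarith
  rw [h, this, one_smul]

theorem eq_of_reflection_eq (hΔ : IsSimpleSystem B Δ) {ρ σ : V} (hρ : ρ ∈ posRoots B Δ)
    (hσ : σ ∈ posRoots B Δ) (h : reflection B ρ = reflection B σ) : ρ = σ := by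
  have h1 := reflection_self (root_unit hΔ hρ.1)
  rw [h, reflection_apply_of_unit (root_unit hΔ hσ.1)] at h1
  refine eq_of_smul_eq hΔ hρ hσ (c := B σ ρ) ?_
  have h2 : (2 : ℝ) • ρ = (2 : ℝ) • (B σ ρ • σ) := by
    rw [sub_eq_iff_eq_add] at h1
    rw [two_smul, smul_smul]
    nth_rw 1 [h1]
    abel
  exact smul_right_injective V two_ne_zero h2

theorem repr_reflection_simple_of_ne (hΔ : IsSimpleSystem B Δ) {i j : ι} (h : j ≠ i) (v : V) :
    Δ.repr (reflection B (Δ i) v) j = Δ.repr v j := by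
  classical
  rw [reflection_apply_of_unit (hΔ.diag i)]
  simp [h.symm]

/-- Only the `i`-th coordinate changes, so a negative image would make all other coordinates of `ρ`
vanish. -/
theorem reflection_simple_mem_posRoots (hΔ : IsSimpleSystem B Δ) {i : ι} {ρ : V}
    (hρ : ρ ∈ posRoots B Δ) (hne : ρ ≠ Δ i) : reflection B (Δ i) ρ ∈ posRoots B Δ := by
  classical
  have hr := apply_mem_roots (reflection_mem_weylGroup (B := B) Δ i) hρ.1
  refine (mem_or_neg_mem_posRoots hΔ hr).resolve_right fun h => hne ?_
  refine eq_of_smul_eq hΔ hρ (simple_mem_posRoots i) (c := Δ.repr ρ i) ?_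
  apply Δ.repr.injective
  ext j
  rw [map_smul, Module.Basis.repr_self, Finsupp.smul_single, smul_eq_mul, mul_one,
    Finsupp.single_apply]
  split_ifs with hij
  · rw [hij]
  · have h1 := mem_cone_iff.1 h.2 j
    rw [map_neg, Finsupp.neg_apply, repr_reflection_simple_of_ne hΔ (Ne.symm hij)] at h1
    linarith [mem_cone_iff.1 hρ.2 j]

end Positivity

open Filter Topology

/-! ### Discreteness of the roots and isotropy of limit roots -/

section Limits

variable {ι V : Type*} [Fintype ι] [NormedAddCommGroup V] [NormedSpace ℝ V]
  {B : LinearMap.BilinForm ℝ V} {Δ : Module.Basis ι ℝ V}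

theorem continuous_bilin (B : LinearMap.BilinForm ℝ V) (Δ : Module.Basis ι ℝ V) :
    Continuous fun p : V × V => B p.1 p.2 := by
  have : FiniteDimensional ℝ V := Module.Finite.of_basis Δ
  exact (LinearMap.toContinuousBilinearMap B).continuous₂

theorem continuous_bilin_self (B : LinearMap.BilinForm ℝ V) (Δ : Module.Basis ι ℝ V) :
    Continuous fun v : V => B v v :=
  (continuous_bilin B Δ).comp (continuous_id.prodMk continuous_id)

theorem continuous_linear (Δ : Module.Basis ι ℝ V) (f : V →ₗ[ℝ] ℝ) : Continuous f := by
  have : FiniteDimensional ℝ V := Module.Finite.of_basis Δ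
  exact f.continuous_of_finiteDimensional

theorem isCompact_box (Δ : Module.Basis ι ℝ V) (C : ℝ) :
    IsCompact {v : V | ∀ i, Δ.repr v i ∈ Set.Icc 0 C} := by
  have h1 : IsCompact (Set.univ.pi fun _ : ι => Set.Icc (0 : ℝ) C) :=
    isCompact_univ_pi fun _ => isCompact_Icc
  have h2 : Continuous Δ.equivFun.symm :=
    LinearMap.continuous_of_finiteDimensional Δ.equivFun.symm.toLinearMap
  convert h1.image h2 using 1
  ext v
  constructor
  · exact fun h => ⟨Δ.equivFun v, fun i _ => h i, Δ.equivFun.symm_apply_apply v⟩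
  · rintro ⟨c, hc, rfl⟩ i
    have : Δ.repr (Δ.equivFun.symm c) i = c i := by
      rw [← Module.Basis.equivFun_apply, LinearEquiv.apply_symm_apply]
    rw [this]
    exact hc i trivial

theorem repr_le_height {v : V} (h : v ∈ cone Δ) (i : ι) : Δ.repr v i ≤ height Δ v := by
  rw [height_apply]
  exact Finset.single_le_sum (fun j _ => mem_cone_iff.1 h j) (Finset.mem_univ i)

/-- The root system is discrete: there are finitely many positive roots of bounded height. -/
theorem finite_posRoots_height_le (hΔ : IsSimpleSystem B Δ) (C : ℝ) :
    {ρ | ρ ∈ posRoots B Δ ∧ height Δ ρ ≤ C}.Finite := by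
  by_contra hinf
  set S := {ρ | ρ ∈ posRoots B Δ ∧ height Δ ρ ≤ C}
  have hS : S ⊆ {v : V | ∀ i, Δ.repr v i ∈ Set.Icc 0 C} := fun ρ hρ i =>
    ⟨mem_cone_iff.1 hρ.1.2 i, (repr_le_height hρ.1.2 i).trans hρ.2⟩
  obtain ⟨x, -, hx⟩ := Set.Infinite.exists_accPt_of_subset_isCompact hinf (isCompact_box Δ C) hS
  have hBx : B x x = 1 := by
    have h1 : x ∈ closure S := derivedSet_subset_closure S hx
    have h2 : IsClosed {v : V | B v v = 1} :=
      isClosed_eq (continuous_bilin_self B Δ) continuous_const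
    exact closure_minimal (fun ρ hρ => root_unit hΔ hρ.1.1) h2 h1
  -- The division-free reflection formula makes `F` continuous everywhere. At `(x, x)` the two
  -- reflections cancel. So for roots ρ, σ near x the product s_ρ s_σ keeps every simple root at
  -- positive height, which forces it to be 1 and ρ = σ.
  let r : V → V → V := fun α v => v - (2 * B α v) • α
  let F : ι → V × V → ℝ := fun i p => height Δ (r p.1 (r p.2 (Δ i)))
  have hb := continuous_bilin B Δ
  have hF : ∀ i, Continuous (F i) := by
    intro i
    have h1 : Continuous fun p : V × V => r p.2 (Δ i) := by
      refine continuous_const.sub ((continuous_const.mul ?_).smul continuous_snd)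
      exact hb.comp (continuous_snd.prodMk continuous_const)
    refine (continuous_linear Δ (height Δ)).comp (h1.sub ((continuous_const.mul ?_).smul
      continuous_fst))
    exact hb.comp (continuous_fst.prodMk h1)
  have hFx : ∀ i, F i (x, x) = 1 := by
    intro i
    have : r x (r x (Δ i)) = Δ i := by
      simp only [r, ← reflection_apply_of_unit hBx, reflection_reflection]
    simp only [F, this, height_simple]
  have hev : ∀ᶠ p in 𝓝 (x, x), ∀ i, 0 < F i p := by
    refine eventually_all.2 fun i => (hF i).continuousAt.eventually (lt_mem_nhds ?_)
    rw [hFx]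
    exact one_pos
  rw [nhds_prod_eq] at hev
  obtain ⟨N, hN, hN'⟩ := (eventually_prod_self_iff (r := fun a b => ∀ i, 0 < F i (a, b))).1 hev
  have hinf2 : (N ∩ S).Infinite := Set.Infinite.of_accPt (hx.nhds_inter hN)
  obtain ⟨ρ, hρ, σ, hσ, hne⟩ := hinf2.nontrivial
  apply hne
  have hρu := root_unit hΔ hρ.2.1.1
  have hσu := root_unit hΔ hσ.2.1.1
  have hw : reflection B ρ * reflection B σ ∈ weylGroup B Δ :=
    mul_mem (reflection_root_mem hΔ hρ.2.1.1) (reflection_root_mem hΔ hσ.2.1.1)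
  have h1 : reflection B ρ * reflection B σ = 1 := by
    refine eq_one_of_forall_mem_cone hΔ hw fun i => ?_
    refine (mem_posRoots_of_height_pos hΔ (apply_mem_roots hw (simple_mem_roots _ i)) ?_).2
    rw [LinearEquiv.mul_apply, reflection_apply_of_unit hρu, reflection_apply_of_unit hσu]
    exact hN' ρ hρ.1 σ hσ.1 i
  refine eq_of_reflection_eq hΔ hρ.2.1 hσ.2.1 ?_
  rw [← reflection_inv σ]
  exact eq_inv_of_mul_eq_one_left h1

theorem normalizeVec_eq (v : V) : normalizeVec Δ v = (height Δ v)⁻¹ • v := by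
  rw [normalizeVec, coordSum_eq_height]

theorem height_normalizeVec {v : V} (h : height Δ v ≠ 0) : height Δ (normalizeVec Δ v) = 1 := by
  rw [normalizeVec_eq, map_smul, smul_eq_mul, inv_mul_cancel₀ h]

theorem normalizeVec_smul {c : ℝ} (hc : c ≠ 0) (v : V) :
    normalizeVec Δ (c • v) = normalizeVec Δ v := by
  rw [normalizeVec_eq, normalizeVec_eq, map_smul, smul_smul, smul_eq_mul, mul_inv]
  congr 1
  field_simp

theorem normalizeVec_neg (v : V) : normalizeVec Δ (-v) = normalizeVec Δ v := by
  rw [← neg_one_smul ℝ v, normalizeVec_smul (by norm_num)]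

theorem bilin_normalizeVec (hΔ : IsSimpleSystem B Δ) {ρ : V} (hρ : ρ ∈ roots B Δ) :
    B (normalizeVec Δ ρ) (normalizeVec Δ ρ) = (height Δ ρ)⁻¹ ^ 2 := by
  rw [normalizeVec_eq, map_smul, map_smul, LinearMap.smul_apply, root_unit hΔ hρ, smul_eq_mul,
    smul_eq_mul]
  ring

theorem bilin_normalizeVec_pos (hΔ : IsSimpleSystem B Δ) {ρ : V} (hρ : ρ ∈ roots B Δ) :
    0 < B (normalizeVec Δ ρ) (normalizeVec Δ ρ) := by
  rw [bilin_normalizeVec hΔ hρ]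
  have := height_ne_zero hΔ hρ
  positivity

theorem normalizeVec_injOn (hΔ : IsSimpleSystem B Δ) :
    Set.InjOn (normalizeVec Δ) (posRoots B Δ) := by
  intro ρ hρ σ hσ h
  have h1 := height_pos hΔ hρ
  rw [normalizeVec_eq, normalizeVec_eq] at h
  refine eq_of_smul_eq hΔ hρ hσ (c := height Δ ρ * (height Δ σ)⁻¹) ?_
  rw [← smul_smul, ← h, smul_smul, mul_inv_cancel₀ h1.ne', one_smul]

theorem exists_posRoot_normalizeVec_eq (hΔ : IsSimpleSystem B Δ) {ρ : V} (hρ : ρ ∈ roots B Δ) :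
    ∃ σ ∈ posRoots B Δ, (σ = ρ ∨ σ = -ρ) ∧ normalizeVec Δ σ = normalizeVec Δ ρ := by
  rcases mem_or_neg_mem_posRoots hΔ hρ with h | h
  · exact ⟨ρ, h, Or.inl rfl, rfl⟩
  · exact ⟨-ρ, h, Or.inr rfl, normalizeVec_neg ρ⟩

theorem isClosed_height_eq_one (Δ : Module.Basis ι ℝ V) : IsClosed {v : V | height Δ v = 1} :=
  isClosed_eq (continuous_linear Δ _) continuous_const

theorem limitSet_mono {A A' : Set V} (h : A ⊆ A') : limitSet Δ A ⊆ limitSet Δ A' :=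
  derivedSet_mono _ _ (Set.image_mono h)

/-- Limit roots are isotropic. -/
theorem limitRoots_subset (hΔ : IsSimpleSystem B Δ) :
    limitRoots B Δ ⊆ normalizedIsotropicCone B Δ := by
  intro x hx
  have hheight : height Δ x = 1 := by
    refine closure_minimal ?_ (isClosed_height_eq_one Δ) (derivedSet_subset_closure _ hx)
    rintro _ ⟨ρ, hρ, rfl⟩
    exact height_normalizeVec (height_ne_zero hΔ hρ)
  refine ⟨?_, by rw [coordSum_eq_height, hheight]⟩
  by_contra hne
  have hε : 0 < |B x x| / 2 := by positivity
  have hU : {v : V | |B x x| / 2 < |B v v|} ∈ 𝓝 x :=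
    (continuous_bilin_self B Δ).abs.continuousAt.eventually (lt_mem_nhds (by
      have := abs_pos.2 hne
      linarith))
  have hinf : ({v : V | |B x x| / 2 < |B v v|} ∩ normalizeVec Δ '' roots B Δ).Infinite :=
    Set.Infinite.of_accPt (AccPt.nhds_inter hx hU)
  -- A lower bound on B(ρ̂, ρ̂) bounds the squared height, and t ≤ 1 + t² supplies the constant.
  refine hinf (((finite_posRoots_height_le hΔ
    (1 + (|B x x| / 2)⁻¹)).image (normalizeVec Δ)).subset ?_)
  rintro _ ⟨hv, ρ, hρ, rfl⟩
  obtain ⟨σ, hσ, -, hσρ⟩ := exists_posRoot_normalizeVec_eq hΔ hρ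
  refine ⟨σ, ⟨hσ, ?_⟩, hσρ⟩
  rw [← hσρ, Set.mem_ofPred_eq, bilin_normalizeVec hΔ hσ.1, abs_of_nonneg (sq_nonneg (height Δ σ)⁻¹)] at hv
  have hpos := height_pos hΔ hσ
  have h2 : height Δ σ ^ 2 < (|B x x| / 2)⁻¹ := by
    rw [inv_pow] at hv
    exact (lt_inv_comm₀ hε (by positivity)).1 hv
  nlinarith [sq_nonneg (height Δ σ - 1)]

/-- Normalized roots lie in a compact box. Normalization identifies ±ρ, so `A` is first folded into
the positive roots, where it is injective. -/
theorem exists_mem_limitSet (hΔ : IsSimpleSystem B Δ) {A : Set V} (hA : A ⊆ roots B Δ)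
    (hinf : A.Infinite) : (limitSet Δ A).Nonempty := by
  set P : Set V := {σ | σ ∈ posRoots B Δ ∧ (σ ∈ A ∨ -σ ∈ A)}
  have hP : P.Infinite := by
    intro hfin
    refine hinf ((hfin.union (hfin.image Neg.neg)).subset fun ρ hρ => ?_)
    rcases mem_or_neg_mem_posRoots hΔ (hA hρ) with h | h
    · exact Or.inl ⟨h, Or.inl hρ⟩
    · exact Or.inr ⟨-ρ, ⟨h, Or.inr (by rwa [neg_neg])⟩, neg_neg ρ⟩
  have hPinf : (normalizeVec Δ '' P).Infinite :=
    hP.image ((normalizeVec_injOn hΔ).mono fun σ hσ => hσ.1)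
  have hbox : normalizeVec Δ '' P ⊆ {v : V | ∀ i, Δ.repr v i ∈ Set.Icc 0 1} := by
    rintro _ ⟨σ, hσ, rfl⟩ i
    have h0 := height_pos hΔ hσ.1
    have h1 : 0 ≤ Δ.repr σ i := mem_cone_iff.1 hσ.1.2 i
    rw [normalizeVec_eq, map_smul, Finsupp.smul_apply, smul_eq_mul]
    refine ⟨by positivity, ?_⟩
    rw [inv_mul_le_iff₀ h0, mul_one]
    exact repr_le_height hσ.1.2 i
  obtain ⟨z, -, hz⟩ := Set.Infinite.exists_accPt_of_subset_isCompact hPinf (isCompact_box Δ 1) hbox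
  refine ⟨z, derivedSet_mono _ _ ?_ hz⟩
  rintro _ ⟨σ, ⟨-, h | h⟩, rfl⟩
  · exact ⟨σ, h, rfl⟩
  · exact ⟨-σ, h, normalizeVec_neg σ⟩

theorem frequently_of_mem_limitSet {A : Set V} {x : V} (hx : x ∈ limitSet Δ A) :
    ∃ᶠ v in 𝓝 x, v ≠ x ∧ v ∈ normalizeVec Δ '' A :=
  accPt_iff_frequently.1 hx

end Limits

/-! ### Dihedral limit roots as isotropic points of lines -/

section Dihedral

variable {ι V : Type*} [Fintype ι] [NormedAddCommGroup V] [NormedSpace ℝ V]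
  {B : LinearMap.BilinForm ℝ V} {Δ : Module.Basis ι ℝ V}

theorem mem_affineSpan_normalizeVec_iff {ρ σ x : V} (hρ : height Δ ρ ≠ 0)
    (hσ : height Δ σ ≠ 0) :
    x ∈ (affineSpan ℝ {normalizeVec Δ ρ, normalizeVec Δ σ} : Set V) ↔
      x ∈ Submodule.span ℝ {ρ, σ} ∧ height Δ x = 1 := by
  rw [SetLike.mem_coe, mem_affineSpan_pair_iff_exists_lineMap_eq, Submodule.mem_span_pair]
  constructor
  · rintro ⟨r, rfl⟩
    rw [AffineMap.lineMap_apply_module]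
    refine ⟨⟨(1 - r) * (height Δ ρ)⁻¹, r * (height Δ σ)⁻¹, ?_⟩, ?_⟩
    · rw [normalizeVec_eq, normalizeVec_eq, smul_smul, smul_smul]
    · rw [map_add, map_smul, map_smul, height_normalizeVec hρ, height_normalizeVec hσ, smul_eq_mul,
        smul_eq_mul]
      ring
  · rintro ⟨⟨a, b, rfl⟩, h⟩
    rw [map_add, map_smul, map_smul, smul_eq_mul, smul_eq_mul] at h
    refine ⟨b * height Δ σ, ?_⟩
    rw [AffineMap.lineMap_apply_module, ← h, normalizeVec_eq, normalizeVec_eq, smul_smul,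
      smul_smul, add_sub_cancel_right, mul_inv_cancel_right₀ hρ, mul_inv_cancel_right₀ hσ]

theorem sub_mem_span_of_mem_dihedralSubgroup {ρ σ : V} {w : V ≃ₗ[ℝ] V}
    (hw : w ∈ dihedralSubgroup B ρ σ) (v : V) : w v - v ∈ Submodule.span ℝ {ρ, σ} := by
  induction hw using Subgroup.closure_induction generalizing v with
  | mem x hx =>
    have key : ∀ α, α ∈ ({ρ, σ} : Set V) → reflection B α v - v ∈ Submodule.span ℝ {ρ, σ} := by
      intro α hα
      change reflectionMap B α v - v ∈ _
      rw [reflectionMap_apply, sub_sub_cancel_left]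
      exact neg_mem (Submodule.smul_mem _ _ (Submodule.subset_span hα))
    rcases hx with rfl | rfl
    · exact key _ (Or.inl rfl)
    · exact key _ (Or.inr rfl)
  | one => simp
  | mul x y _ _ hx hy =>
    have := add_mem (hx (y v)) (hy v)
    rwa [sub_add_sub_cancel] at this
  | inv x _ hx =>
    have := neg_mem (hx (x⁻¹ v))
    rw [neg_sub] at this
    rwa [show x (x⁻¹ v) = v from x.apply_symm_apply v] at this

/-- Elements of the subgroup move vectors only by vectors of the span, and s_τ moves τ by −2τ. -/
theorem subsystem_subset_span (hΔ : IsSimpleSystem B Δ) (ρ σ : V) :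
    subsystem B Δ (dihedralSubgroup B ρ σ) ⊆ Submodule.span ℝ {ρ, σ} := by
  rintro τ ⟨hτ, hw⟩
  have h := sub_mem_span_of_mem_dihedralSubgroup hw τ
  rw [reflection_self (root_unit hΔ hτ)] at h
  have h2 := Submodule.smul_mem _ (-(1 / 2) : ℝ) h
  rwa [show (-(1 / 2) : ℝ) • (-τ - τ) = τ by module] at h2

theorem limitSet_subsystem_subset_span (hΔ : IsSimpleSystem B Δ) (ρ σ : V) :
    limitSet Δ (subsystem B Δ (dihedralSubgroup B ρ σ)) ⊆ Submodule.span ℝ {ρ, σ} := by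
  have : FiniteDimensional ℝ V := Module.Finite.of_basis Δ
  refine (derivedSet_subset_closure _).trans (closure_minimal ?_
    (Submodule.closed_of_finiteDimensional _))
  rintro _ ⟨τ, hτ, rfl⟩
  rw [normalizeVec_eq]
  exact Submodule.smul_mem _ _ (subsystem_subset_span hΔ ρ σ hτ)

theorem limitSet_subsystem_subset_cone (hΔ : IsSimpleSystem B Δ) (ρ σ : V) :
    limitSet Δ (subsystem B Δ (dihedralSubgroup B ρ σ)) ⊆ normalizedIsotropicCone B Δ :=
  (limitSet_mono fun _ h => h.1).trans (limitRoots_subset hΔ)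

theorem apply_mem_subsystem (hΔ : IsSimpleSystem B Δ) {W' : Subgroup (V ≃ₗ[ℝ] V)}
    {w : V ≃ₗ[ℝ] V} (hw : w ∈ weylGroup B Δ) (hw' : w ∈ W') {τ : V}
    (hτ : τ ∈ subsystem B Δ W') : w τ ∈ subsystem B Δ W' := by
  refine ⟨apply_mem_roots hw hτ.1, ?_⟩
  rw [reflection_map_of_isometry w (weylGroup_isometry hΔ.symm hΔ.diag hw) (root_unit hΔ hτ.1)]
  exact mul_mem (mul_mem hw' hτ.2) (inv_mem hw')

theorem rotation_pow_apply (hB : ∀ u v, B u v = B v u) {ρ σ : V} (hρ : B ρ ρ = 1)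
    (hσ : B σ σ = 1) (n : ℕ) :
    ((reflection B ρ * reflection B σ) ^ n) ρ =
      (chebSeq (2 * B ρ σ ^ 2 - 1) (n + 1) + chebSeq (2 * B ρ σ ^ 2 - 1) n) • ρ -
        (2 * B ρ σ * chebSeq (2 * B ρ σ ^ 2 - 1) n) • σ := by
  induction n with
  | zero => simp [chebSeq]
  | succ n ih =>
    rw [pow_succ', LinearEquiv.mul_apply, ih, LinearEquiv.mul_apply]
    simp only [map_sub, map_smul, map_neg, reflection_self hσ, reflection_apply_of_unit hσ ρ, hB σ ρ,
      reflection_self hρ, reflection_apply_of_unit hρ σ]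
    simp only [chebSeq]
    module

/-- The coefficient of `σ` is a nonzero multiple of the `n`-th term of a strictly increasing
sequence. Two equal images with different coefficients would make `σ` proportional to `ρ`. -/
theorem injective_rotation_pow_apply (hΔ : IsSimpleSystem B Δ) {ρ σ : V} (hρ : ρ ∈ posRoots B Δ)
    (hσ : σ ∈ posRoots B Δ) (hne : ρ ≠ σ) (hc : 1 ≤ B ρ σ ^ 2) :
    Function.Injective fun n : ℕ => ((reflection B ρ * reflection B σ) ^ n) ρ := by
  intro n m h
  simp only [rotation_pow_apply hΔ.symm (root_unit hΔ hρ.1) (root_unit hΔ hσ.1)] at h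
  set a := 2 * B ρ σ ^ 2 - 1
  have ha : 1 ≤ a := by linarith
  have hmono : StrictMono (chebSeq a) :=
    strictMono_nat_of_lt_succ fun k => by linarith [(chebSeq_add_one_le ha k).2]
  apply hmono.injective
  by_contra hnm
  apply hne
  have hc0 : B ρ σ ≠ 0 := by
    intro h0
    rw [h0] at hc
    norm_num at hc
  have hd : 2 * B ρ σ * (chebSeq a n - chebSeq a m) ≠ 0 :=
    mul_ne_zero (mul_ne_zero two_ne_zero hc0) (sub_ne_zero.2 hnm)
  refine (eq_of_smul_eq hΔ hσ hρ (c := (2 * B ρ σ * (chebSeq a n - chebSeq a m))⁻¹ *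
    (chebSeq a (n + 1) + chebSeq a n - (chebSeq a (m + 1) + chebSeq a m))) ?_).symm
  rw [mul_smul, eq_inv_smul_iff₀ hd]
  linear_combination (norm := module) -h

/-- If |B(ρ, σ)| < 1, the form is positive definite on the plane. -/
theorem one_le_sq_of_isotropic (hB : ∀ u v, B u v = B v u) {ρ σ : V} (hρ : B ρ ρ = 1)
    (hσ : B σ σ = 1) {a b : ℝ} (h : B (a • ρ + b • σ) (a • ρ + b • σ) = 0)
    (h0 : a • ρ + b • σ ≠ 0) :
    1 ≤ B ρ σ ^ 2 ∧ b ≠ 0 ∧ a ^ 2 + 2 * a * b * B ρ σ + b ^ 2 = 0 := by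
  simp only [map_add, map_smul, LinearMap.add_apply, LinearMap.smul_apply, smul_eq_mul, hρ, hσ,
    hB σ ρ] at h
  have h1 : a ^ 2 + 2 * a * b * B ρ σ + b ^ 2 = 0 := by linear_combination h
  have hb : b ≠ 0 := by
    rintro rfl
    have : a = 0 := by nlinarith
    simp [this] at h0
  refine ⟨?_, hb, h1⟩
  by_contra! hlt
  have : 0 < b ^ 2 := by positivity
  nlinarith [sq_nonneg (a + b * B ρ σ)]

theorem isotropicLinePoints_subset (hΔ : IsSimpleSystem B Δ) :
    isotropicLinePoints B Δ ⊆ dihedralLimitRoots B Δ := by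
  rintro x ⟨ρ, hρ, σ, hσ, hne, hx, hxB, -⟩
  rw [mem_affineSpan_normalizeVec_iff (height_pos hΔ hρ).ne' (height_pos hΔ hσ).ne',
    Submodule.mem_span_pair] at hx
  obtain ⟨⟨a, b, rfl⟩, hx1⟩ := hx
  have hρu := root_unit hΔ hρ.1
  have hσu := root_unit hΔ hσ.1
  have ne0 : ∀ v : V, height Δ v = 1 → v ≠ 0 := by
    rintro v hv rfl
    simp at hv
  obtain ⟨hc, hb, hab⟩ := one_le_sq_of_isotropic hΔ.symm hρu hσu hxB (ne0 _ hx1)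
  have hinj := injective_rotation_pow_apply hΔ hρ hσ hne hc
  have hsρ : reflection B ρ ∈ dihedralSubgroup B ρ σ := Subgroup.subset_closure (Or.inl rfl)
  have hsσ : reflection B σ ∈ dihedralSubgroup B ρ σ := Subgroup.subset_closure (Or.inr rfl)
  have hwρ := reflection_root_mem hΔ hρ.1
  have hwσ := reflection_root_mem hΔ hσ.1
  refine ⟨ρ, hρ, σ, hσ, hne, ?_, ?_⟩
  · refine Set.infinite_of_injective_forall_mem
      (f := fun n : ℕ => (reflection B ρ * reflection B σ) ^ n) (fun n m h => hinj ?_)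
      fun n => pow_mem (mul_mem hsρ hsσ) n
    exact congrArg (fun w : V ≃ₗ[ℝ] V => w ρ) h
  have hinf : (subsystem B Δ (dihedralSubgroup B ρ σ)).Infinite :=
    Set.infinite_of_injective_forall_mem hinj fun n =>
      apply_mem_subsystem hΔ (pow_mem (mul_mem hwρ hwσ) n) (pow_mem (mul_mem hsρ hsσ) n)
        ⟨hρ.1, hsρ⟩
  obtain ⟨z, hz⟩ := exists_mem_limitSet hΔ (fun _ h => h.1) hinf
  -- Compactness does not say which isotropic point was found; if it is the other one, s_ρ
  -- transports it to the required point.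
  by_cases hzx : z = a • ρ + b • σ
  · rwa [← hzx]
  obtain ⟨hzB, hz1⟩ := limitSet_subsystem_subset_cone hΔ ρ σ hz
  rw [coordSum_eq_height] at hz1
  obtain ⟨p, q, rfl⟩ := Submodule.mem_span_pair.1 (limitSet_subsystem_subset_span hΔ ρ σ hz)
  obtain ⟨-, hq, hpq⟩ := one_le_sq_of_isotropic hΔ.symm hρu hσu hzB (ne0 _ hz1)
  have hdet : a * q - p * b ≠ 0 := by
    intro h0
    apply hzx
    have h2 : q • (a • ρ + b • σ) = b • (p • ρ + q • σ) := by
      linear_combination (norm := module) h0 • ρ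
    have h3 := congrArg (height Δ) h2
    rw [map_smul, map_smul, hx1, hz1, smul_eq_mul, smul_eq_mul, mul_one, mul_one] at h3
    rw [h3] at h2
    exact (smul_right_injective V hb (h3 ▸ h2)).symm
  -- Vieta: a/b and p/q are the two distinct roots of t² + 2B(ρ, σ)t + 1.
  have hsum : a * q + p * b + 2 * b * q * B ρ σ = 0 := by
    refine (mul_eq_zero.1 (?_ : (a * q - p * b) * _ = 0)).resolve_left hdet
    linear_combination q ^ 2 * hab - b ^ 2 * hpq
  have hsz : reflection B ρ (p • ρ + q • σ) = (q / b) • (a • ρ + b • σ) := by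
    have h1 : q / b * a = -p - 2 * q * B ρ σ := by
      field_simp
      linear_combination hsum
    have h2 : q / b * b = q := div_mul_cancel₀ q hb
    rw [smul_add, smul_smul, smul_smul, h1, h2, map_add, map_smul, map_smul, reflection_self hρu,
      reflection_apply_of_unit hρu]
    module
  have hκ : q / b ≠ 0 := div_ne_zero hq hb
  have hheight : height Δ (reflection B ρ (p • ρ + q • σ)) = q / b := by
    rw [hsz, map_smul, hx1, smul_eq_mul, mul_one]
  have : FiniteDimensional ℝ V := Module.Finite.of_basis Δ
  have hcont : Continuous (reflection B ρ) :=
    (reflection B ρ).toLinearMap.continuous_of_finiteDimensional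
  have htend : Tendsto (fun v => normalizeVec Δ (reflection B ρ v)) (𝓝 (p • ρ + q • σ))
      (𝓝 (a • ρ + b • σ)) := by
    have h1 : ContinuousAt (fun v => (height Δ (reflection B ρ v))⁻¹ • reflection B ρ v)
        (p • ρ + q • σ) := by
      refine ContinuousAt.smul (ContinuousAt.inv₀
        ((continuous_linear Δ (height Δ)).comp hcont).continuousAt ?_) hcont.continuousAt
      rw [hheight]
      exact hκ
    have h2 := h1.tendsto
    rw [hheight, hsz, smul_smul, inv_mul_cancel₀ hκ, one_smul] at h2
    simpa only [normalizeVec_eq] using h2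
  refine accPt_iff_frequently.2 (htend.frequently ?_)
  refine (frequently_of_mem_limitSet hz).mono ?_
  rintro _ ⟨-, τ, hτ, rfl⟩
  have h1 : normalizeVec Δ (reflection B ρ (normalizeVec Δ τ)) =
      normalizeVec Δ (reflection B ρ τ) := by
    rw [normalizeVec_eq τ, map_smul, normalizeVec_smul (inv_ne_zero (height_ne_zero hΔ hτ.1))]
  have h2 := apply_mem_subsystem hΔ hwρ hsρ hτ
  rw [h1]
  -- The transported points differ from the limit because normalized roots are not isotropic.
  refine ⟨fun h => ?_, _, h2, rfl⟩
  have h3 := bilin_normalizeVec_pos hΔ h2.1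
  rw [h, hxB] at h3
  exact lt_irrefl _ h3

theorem dihedralLimitRoots_eq (hΔ : IsSimpleSystem B Δ) :
    dihedralLimitRoots B Δ = isotropicLinePoints B Δ := by
  refine Set.Subset.antisymm ?_ (isotropicLinePoints_subset hΔ)
  rintro x ⟨ρ, hρ, σ, hσ, hne, -, hx⟩
  have hxQ := limitSet_subsystem_subset_cone hΔ ρ σ hx
  refine ⟨ρ, hρ, σ, hσ, hne, ?_, hxQ⟩
  rw [mem_affineSpan_normalizeVec_iff (height_pos hΔ hρ).ne' (height_pos hΔ hσ).ne',
    ← coordSum_eq_height]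
  exact ⟨limitSet_subsystem_subset_span hΔ ρ σ hx, hxQ.2⟩

theorem dihedralLimitRoots_subset :
    dihedralLimitRoots B Δ ⊆ limitRoots B Δ := by
  rintro x ⟨ρ, -, σ, -, -, -, hx⟩
  exact limitSet_mono (fun _ h => h.1) hx

end Dihedral

/-! ### Coordinate subspaces -/

section Supported

variable {ι V : Type*} [AddCommGroup V] [Module ℝ V] {Δ : Module.Basis ι ℝ V}

/-- The span of the simple roots indexed by `J`. -/
def supported (Δ : Module.Basis ι ℝ V) (J : Set ι) : Submodule ℝ V where
  carrier := {v | ∀ i, i ∉ J → Δ.repr v i = 0}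
  add_mem' {u v} hu hv i hi := by simp [hu i hi, hv i hi]
  zero_mem' i _ := by simp
  smul_mem' c v hv i hi := by simp [hv i hi]

theorem simple_mem_supported {J : Set ι} {i : ι} (hi : i ∈ J) : Δ i ∈ supported Δ J := by
  classical
  intro j hj
  rw [Module.Basis.repr_self, Finsupp.single_apply, if_neg]
  rintro rfl
  exact hj hi

end Supported

/-! ### Density at limit roots outside the radical -/

section Density

variable {ι V : Type*} [Fintype ι] [NormedAddCommGroup V] [NormedSpace ℝ V]
  {B : LinearMap.BilinForm ℝ V} {Δ : Module.Basis ι ℝ V}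

/-- The normalization of `v + s v • η` is continuous at `x` with value `x`. For v = ρ̂ it lies on
the line through ρ̂ and the normalized `η`, so it suffices to find a small `s v` making the vector
isotropic. -/
theorem mem_closure_of_frequently (hΔ : IsSimpleSystem B Δ) {x η : V} (hx : height Δ x = 1)
    (hη : η ∈ posRoots B Δ) {s : V → ℝ} (hs : ContinuousAt s x) (hs0 : s x = 0)
    (hf : ∃ᶠ v in 𝓝 x, ∃ ρ ∈ posRoots B Δ, ρ ≠ η ∧ normalizeVec Δ ρ = v ∧
      B (v + s v • η) (v + s v • η) = 0) : x ∈ closure (isotropicLinePoints B Δ) := by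
  have hh := continuous_linear Δ (height Δ)
  have h1 : ContinuousAt (fun v => v + s v • η) x := continuousAt_id.add (hs.smul continuousAt_const)
  have h2 : ContinuousAt (fun v => height Δ (v + s v • η)) x :=
    ContinuousAt.comp (g := height Δ) hh.continuousAt h1
  have hx0 : height Δ (x + s x • η) = 1 := by rw [hs0, zero_smul, add_zero, hx]
  have hne : ∀ᶠ v in 𝓝 x, height Δ (v + s v • η) ≠ 0 :=
    h2.eventually_ne (by rw [hx0]; exact one_ne_zero)
  have h3 : ContinuousAt (fun v => normalizeVec Δ (v + s v • η)) x := by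
    simp only [normalizeVec_eq]
    exact (h2.inv₀ (by rw [hx0]; exact one_ne_zero)).smul h1
  have h4 := h3.tendsto
  rw [normalizeVec_eq, hx0, inv_one, one_smul, hs0, zero_smul, add_zero] at h4
  refine mem_closure_iff_frequently.2 (h4.frequently ((hf.and_eventually hne).mono ?_))
  rintro _ ⟨⟨ρ, hρ, hρη, rfl, hB⟩, hv⟩
  refine ⟨ρ, hρ, η, hη, hρη, ?_, ?_, ?_⟩
  · rw [mem_affineSpan_normalizeVec_iff (height_pos hΔ hρ).ne' (height_pos hΔ hη).ne',
      height_normalizeVec hv]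
    refine ⟨?_, rfl⟩
    rw [normalizeVec_eq (_ + _), normalizeVec_eq]
    exact Submodule.smul_mem _ _ (add_mem (Submodule.smul_mem _ _
      (Submodule.subset_span (Or.inl rfl))) (Submodule.smul_mem _ _
      (Submodule.subset_span (Or.inr rfl))))
  · rw [normalizeVec_eq (_ + _), map_smul, map_smul, LinearMap.smul_apply, hB, smul_zero,
      smul_zero]
  · rw [coordSum_eq_height, height_normalizeVec hv]

theorem frequently_posRoots_of_mem_limitRoots (hΔ : IsSimpleSystem B Δ) {x : V}
    (hx : x ∈ limitRoots B Δ) :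
    ∃ᶠ v in 𝓝 x, ∃ ρ ∈ posRoots B Δ, normalizeVec Δ ρ = v := by
  refine (frequently_of_mem_limitSet hx).mono ?_
  rintro _ ⟨-, ρ, hρ, rfl⟩
  obtain ⟨σ, hσ, -, h⟩ := exists_posRoot_normalizeVec_eq hΔ hρ
  exact ⟨σ, hσ, h⟩

theorem eventually_ne_normalizeVec (hΔ : IsSimpleSystem B Δ) {x η : V} (hx : B x x = 0)
    (hη : η ∈ roots B Δ) : ∀ᶠ v in 𝓝 x, v ≠ normalizeVec Δ η := by
  refine isOpen_ne.mem_nhds ?_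
  rintro rfl
  exact (bilin_normalizeVec_pos hΔ hη).ne' hx

theorem mem_closure_of_bilin_ne_zero (hΔ : IsSimpleSystem B Δ) {x : V} (hx : x ∈ limitRoots B Δ)
    {i : ι} (hi : B (Δ i) x ≠ 0) : x ∈ closure (isotropicLinePoints B Δ) := by
  obtain ⟨hxB, hx1⟩ := limitRoots_subset hΔ hx
  rw [coordSum_eq_height] at hx1
  set b := B (Δ i) x
  have hβ : Continuous fun v => B (Δ i) v := continuous_linear Δ _
  have hγ := continuous_bilin_self B Δ
  have hδ : Continuous fun v => B (Δ i) v ^ 2 - B v v := (hβ.pow 2).sub hγ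
  have hε : (b / |b|) ^ 2 = 1 := by
    rw [div_pow, sq_abs, div_self (pow_ne_zero 2 hi)]
  have hpos : ∀ᶠ v in 𝓝 x, 0 < B (Δ i) v ^ 2 - B v v := by
    refine hδ.continuousAt.eventually (lt_mem_nhds ?_)
    change 0 < b ^ 2 - B x x
    rw [hxB, sub_zero]
    positivity
  -- `s v` solves t² + 2tB(α, v) + B(v, v) = 0 for α = `Δ i`; the sign `b / |b|` picks the branch
  -- vanishing at `x`.
  refine mem_closure_of_frequently hΔ hx1 (simple_mem_posRoots i)
    (s := fun v => -B (Δ i) v + b / |b| * √(B (Δ i) v ^ 2 - B v v))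
    (hβ.neg.add (continuous_const.mul hδ.sqrt)).continuousAt ?_ ?_
  · change -b + b / |b| * √(b ^ 2 - B x x) = 0
    rw [hxB, sub_zero, Real.sqrt_sq_eq_abs, div_mul_cancel₀ _ (abs_ne_zero.2 hi), neg_add_cancel]
  · refine ((frequently_posRoots_of_mem_limitRoots hΔ hx).and_eventually (hpos.and
      (eventually_ne_normalizeVec hΔ hxB (simple_mem_roots _ i)))).mono ?_
    rintro v ⟨⟨ρ, hρ, hv⟩, hlt, hne⟩
    refine ⟨ρ, hρ, ?_, hv, ?_⟩
    · rintro rfl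
      exact hne hv.symm
    · simp only [map_add, map_smul, LinearMap.add_apply, LinearMap.smul_apply, smul_eq_mul,
        hΔ.diag, hΔ.symm v (Δ i)]
      linear_combination Real.sq_sqrt hlt.le + √(B (Δ i) v ^ 2 - B v v) ^ 2 * hε

theorem linear_expand {M : Type*} [AddCommGroup M] [Module ℝ M] (f : V →ₗ[ℝ] M) (v : V) :
    f v = ∑ i, Δ.repr v i • f (Δ i) := by
  conv_lhs => rw [← Δ.sum_repr v]
  rw [map_sum]
  simp only [map_smul]

theorem bilin_expand_left (u v : V) : B u v = ∑ i, Δ.repr u i * B (Δ i) v := by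
  rw [linear_expand (Δ := Δ) B u]
  simp

theorem bilin_expand (u v : V) :
    B u v = ∑ i, ∑ j, Δ.repr u i * Δ.repr v j * B (Δ i) (Δ j) := by
  rw [bilin_expand_left (Δ := Δ)]
  refine Finset.sum_congr rfl fun i _ => ?_
  rw [linear_expand (Δ := Δ) (B (Δ i)) v, Finset.mul_sum]
  refine Finset.sum_congr rfl fun j _ => ?_
  rw [smul_eq_mul, mul_assoc]

theorem bilin_simple_nonpos (hΔ : IsSimpleSystem B Δ) {i j : ι} (h : i ≠ j) :
    B (Δ i) (Δ j) ≤ 0 := by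
  rcases hΔ.off_diag i j h with h | ⟨k, hk, h⟩
  · linarith
  · rw [h, neg_nonpos]
    have hk' : (2 : ℝ) ≤ k := by exact_mod_cast hk
    have h1 : Real.pi / k ≤ Real.pi / 2 := by
      gcongr
    have h2 : 0 ≤ Real.pi / k := by positivity
    exact Real.cos_nonneg_of_neg_pi_div_two_le_of_le (by linarith [Real.pi_pos]) h1

/-! ### Roots in anisotropic parabolic subspaces -/

/-- A submodule without nonzero isotropic vectors contains finitely many roots. -/
theorem finite_roots_inter (hΔ : IsSimpleSystem B Δ) {U : Submodule ℝ V}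
    (hU : ∀ v ∈ U, B v v = 0 → v = 0) : (roots B Δ ∩ U).Finite := by
  by_contra hinf
  obtain ⟨z, hz⟩ := exists_mem_limitSet hΔ Set.inter_subset_left hinf
  have : FiniteDimensional ℝ V := Module.Finite.of_basis Δ
  have hzU : z ∈ U := by
    refine closure_minimal ?_ (Submodule.closed_of_finiteDimensional U)
      (derivedSet_subset_closure _ hz)
    rintro _ ⟨τ, hτ, rfl⟩
    rw [normalizeVec_eq]
    exact Submodule.smul_mem _ _ hτ.2
  obtain ⟨hzB, hz1⟩ := limitRoots_subset hΔ (limitSet_mono Set.inter_subset_left hz)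
  rw [coordSum_eq_height, hU z hzU hzB, map_zero] at hz1
  exact zero_ne_one hz1

/-- The roots lying in a standard parabolic subspace without nonzero isotropic vectors. -/
def anisotropicRoots (B : LinearMap.BilinForm ℝ V) (Δ : Module.Basis ι ℝ V) : Set V :=
  {ρ | ρ ∈ roots B Δ ∧ ∃ J, (∀ v ∈ supported Δ J, B v v = 0 → v = 0) ∧ ρ ∈ supported Δ J}

theorem finite_anisotropicRoots (hΔ : IsSimpleSystem B Δ) : (anisotropicRoots B Δ).Finite := by
  refine (Set.finite_iUnion (ι := {J : Set ι // ∀ v ∈ supported Δ J, B v v = 0 → v = 0})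
    fun J => finite_roots_inter hΔ J.2).subset ?_
  rintro ρ ⟨hρ, J, hJ, h⟩
  exact Set.mem_iUnion.2 ⟨⟨J, hJ⟩, hρ, h⟩

/-- The span of the simple roots in the support of `x`. -/
abbrev suppSpan (Δ : Module.Basis ι ℝ V) (x : V) : Submodule ℝ V :=
  supported Δ {i | Δ.repr x i ≠ 0}

/-! ### Cone vectors in the radical: the semidefinite case -/

/-- A vector of the cone that lies in the radical of `B`. -/
structure IsConeRadical (B : LinearMap.BilinForm ℝ V) (Δ : Module.Basis ι ℝ V) (x : V) :
    Prop where
  nonneg : ∀ i, 0 ≤ Δ.repr x i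
  rad : ∀ i, B (Δ i) x = 0

/-- Off the support, the equation B(Δ j, x) = 0 is a vanishing sum of nonpositive terms. -/
theorem IsConeRadical.bilin_eq_zero {x : V} (hx : IsConeRadical B Δ x) (hΔ : IsSimpleSystem B Δ)
    {i j : ι} (hi : Δ.repr x i ≠ 0) (hj : Δ.repr x j = 0) : B (Δ i) (Δ j) = 0 := by
  have h1 := hx.rad j
  rw [linear_expand (Δ := Δ) (B (Δ j)) x, Finset.sum_eq_zero_iff_of_nonpos] at h1
  · have := h1 i (Finset.mem_univ i)
    rw [hΔ.symm]
    exact (mul_eq_zero.1 this).resolve_left hi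
  · intro k _
    rcases eq_or_ne k j with rfl | hk
    · rw [hj, zero_smul]
    · exact mul_nonpos_of_nonneg_of_nonpos (hx.nonneg k) (bilin_simple_nonpos hΔ hk.symm)

theorem IsConeRadical.bilin_simple_eq_zero {x : V} (hx : IsConeRadical B Δ x)
    (hΔ : IsSimpleSystem B Δ) {v : V} (hv : v ∈ suppSpan Δ x) {j : ι} (hj : Δ.repr x j = 0) :
    B v (Δ j) = 0 := by
  rw [bilin_expand_left (Δ := Δ)]
  refine Finset.sum_eq_zero fun i _ => ?_
  by_cases hi : Δ.repr x i = 0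
  · rw [hv i (by simpa using hi), zero_mul]
  · rw [hx.bilin_eq_zero hΔ hi hj, mul_zero]

/-- With v = Σ d_i X_i Δ_i, the vanishing row sums of X_i X_j B(Δ_i, Δ_j) turn B(v, v) into −½ Σ X_i
X_j B(Δ_i, Δ_j)(d_i − d_j)², whose terms are nonnegative. -/
theorem IsConeRadical.bilin_self_nonneg {x : V} (hx : IsConeRadical B Δ x)
    (hΔ : IsSimpleSystem B Δ) {v : V} (hv : v ∈ suppSpan Δ x) : 0 ≤ B v v := by
  set X := Δ.repr x
  set d : ι → ℝ := fun i => Δ.repr v i / X i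
  have hc : ∀ i, Δ.repr v i = d i * X i := by
    intro i
    by_cases hi : X i = 0
    · rw [hi, mul_zero]
      exact hv i (by simpa using hi)
    · exact (div_mul_cancel₀ _ hi).symm
  have hsum : ∀ i, ∑ j, X j * B (Δ i) (Δ j) = 0 := by
    intro i
    rw [← hx.rad i, linear_expand (Δ := Δ) (B (Δ i)) x]
    rfl
  have h1 : ∑ i, ∑ j, X i * X j * B (Δ i) (Δ j) * (d i ^ 2 / 2) = 0 := by
    refine Finset.sum_eq_zero fun i _ => ?_
    have h := congrArg (X i * (d i ^ 2 / 2) * ·) (hsum i)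
    simp only [mul_zero, Finset.mul_sum] at h
    rw [← h]
    exact Finset.sum_congr rfl fun j _ => by ring
  have h2 : ∑ i, ∑ j, X i * X j * B (Δ i) (Δ j) * (d j ^ 2 / 2) = 0 := by
    rw [Finset.sum_comm, ← h1]
    refine Finset.sum_congr rfl fun i _ => Finset.sum_congr rfl fun j _ => ?_
    rw [hΔ.symm]
    ring
  have h3 : (0 : ℝ) = ∑ i, ∑ j, (X i * X j * B (Δ i) (Δ j) * (d i ^ 2 / 2) +
      X i * X j * B (Δ i) (Δ j) * (d j ^ 2 / 2)) := by
    simp only [Finset.sum_add_distrib, h1, h2, add_zero]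
  rw [h3, bilin_expand (Δ := Δ)]
  refine Finset.sum_le_sum fun i _ => Finset.sum_le_sum fun j _ => ?_
  rw [hc i, hc j]
  rcases eq_or_ne i j with rfl | hij
  · apply le_of_eq
    ring
  · have h4 : X i * X j * B (Δ i) (Δ j) ≤ 0 :=
      mul_nonpos_of_nonneg_of_nonpos (mul_nonneg (hx.nonneg i) (hx.nonneg j))
        (bilin_simple_nonpos hΔ hij)
    nlinarith [mul_nonneg (neg_nonneg.2 h4) (sq_nonneg (d i - d j))]

theorem IsConeRadical.bilin_eq_zero_of_isotropic {x : V} (hx : IsConeRadical B Δ x)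
    (hΔ : IsSimpleSystem B Δ) {u r : V} (hu : u ∈ suppSpan Δ x) (hr : r ∈ suppSpan Δ x)
    (h : B r r = 0) : B u r = 0 := by
  by_contra hne
  -- The scalar is chosen so that the form takes the value −1 on this vector.
  have h1 := hx.bilin_self_nonneg hΔ
    (add_mem hu (Submodule.smul_mem _ (-(B u u + 1) / (2 * B u r)) hr))
  simp only [map_add, map_smul, LinearMap.add_apply, LinearMap.smul_apply, smul_eq_mul, h,
    hΔ.symm r u] at h1
  have h2 : -(B u u + 1) / (2 * B u r) * B u r = -(B u u + 1) / 2 := by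
    field_simp
  linarith

theorem IsConeRadical.abs_bilin_le_one {x : V} (hx : IsConeRadical B Δ x)
    (hΔ : IsSimpleSystem B Δ) {u v : V} (hu : u ∈ roots B Δ) (hv : v ∈ roots B Δ)
    (hu' : u ∈ suppSpan Δ x) (hv' : v ∈ suppSpan Δ x) : |B u v| ≤ 1 := by
  have h1 := hx.bilin_self_nonneg hΔ (add_mem hu' hv')
  have h2 := hx.bilin_self_nonneg hΔ (sub_mem hu' hv')
  simp only [map_add, map_sub, LinearMap.add_apply, LinearMap.sub_apply, root_unit hΔ hu,
    root_unit hΔ hv, hΔ.symm v u] at h1 h2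
  rw [abs_le]
  constructor <;> linarith

theorem reflection_mem_suppSpan (hΔ : IsSimpleSystem B Δ) {x v : V} {i : ι}
    (hi : Δ.repr x i ≠ 0) (hv : v ∈ suppSpan Δ x) : reflection B (Δ i) v ∈ suppSpan Δ x := by
  rw [reflection_apply_of_unit (hΔ.diag i)]
  exact sub_mem hv (Submodule.smul_mem _ _ (simple_mem_supported hi))

/-- The support and its complement are orthogonal, so simple reflections from one side fix the span
of the other. -/
theorem IsConeRadical.mem_supported_of_root {x : V} (hx : IsConeRadical B Δ x)
    (hΔ : IsSimpleSystem B Δ) {ρ : V} (hρ : ρ ∈ roots B Δ) :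
    ρ ∈ suppSpan Δ x ∨ ρ ∈ supported Δ {i | Δ.repr x i = 0} := by
  refine roots_induction (P := fun ρ => ρ ∈ suppSpan Δ x ∨
    ρ ∈ supported Δ {i | Δ.repr x i = 0}) (fun i => ?_) (fun i v hv => ?_) hρ
  · by_cases hi : Δ.repr x i = 0
    · exact Or.inr (simple_mem_supported hi)
    · exact Or.inl (simple_mem_supported hi)
  · rw [reflection_apply_of_unit (hΔ.diag i)]
    by_cases hi : Δ.repr x i = 0
    · rcases hv with hv | hv
      · rw [hΔ.symm, hx.bilin_simple_eq_zero hΔ hv hi, mul_zero, zero_smul, sub_zero]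
        exact Or.inl hv
      · exact Or.inr (sub_mem hv (Submodule.smul_mem _ _ (simple_mem_supported hi)))
    · rcases hv with hv | hv
      · exact Or.inl (sub_mem hv (Submodule.smul_mem _ _ (simple_mem_supported hi)))
      · have h0 : B (Δ i) v = 0 := by
          rw [hΔ.symm, bilin_expand_left (Δ := Δ)]
          refine Finset.sum_eq_zero fun j _ => ?_
          by_cases hj : Δ.repr x j = 0
          · rw [hΔ.symm, hx.bilin_eq_zero hΔ hi hj, mul_zero]
          · rw [hv j hj, zero_mul]
        rw [h0, mul_zero, zero_smul, sub_zero]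
        exact Or.inr hv

/-- If a linear form agrees with the height on the isotropic vectors of `suppSpan Δ x`, then the span
of the simple roots of `suppSpan Δ x` on which it vanishes has no nonzero isotropic vectors. -/
theorem IsConeRadical.eq_zero_of_isotropic {x : V} (hx : IsConeRadical B Δ x)
    (hΔ : IsSimpleSystem B Δ) {f : V →ₗ[ℝ] ℝ}
    (hf : ∀ r ∈ suppSpan Δ x, B r r = 0 → f r = height Δ r) {v : V}
    (hv : v ∈ supported Δ {i | Δ.repr x i ≠ 0 ∧ f (Δ i) = 0}) (h : B v v = 0) : v = 0 := by
  -- Absolute values of coordinates do not increase B, as off-diagonal entries are nonpositive. So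
  -- `u` is isotropic, and its height equals f u = 0.
  set u : V := ∑ i, |Δ.repr v i| • Δ i
  have hu : ∀ i, Δ.repr u i = |Δ.repr v i| := fun i => by
    rw [Δ.repr_sum_self]
  have hux : u ∈ suppSpan Δ x := by
    intro i hi
    rw [hu, hv i fun h => hi h.1, abs_zero]
  have hle : B u u ≤ B v v := by
    rw [bilin_expand (Δ := Δ), bilin_expand (Δ := Δ)]
    refine Finset.sum_le_sum fun i _ => Finset.sum_le_sum fun j _ => ?_
    rw [hu, hu]
    rcases eq_or_ne i j with rfl | hij
    · rw [abs_mul_abs_self]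
    · rw [← abs_mul]
      exact mul_le_mul_of_nonpos_right (le_abs_self _) (bilin_simple_nonpos hΔ hij)
  have hu0 : B u u = 0 := le_antisymm (hle.trans h.le) (hx.bilin_self_nonneg hΔ hux)
  have hfu : f u = 0 := by
    rw [linear_expand (Δ := Δ) f u]
    refine Finset.sum_eq_zero fun i _ => ?_
    by_cases hi : Δ.repr x i ≠ 0 ∧ f (Δ i) = 0
    · rw [hi.2, smul_zero]
    · rw [hu, hv i hi, abs_zero, zero_smul]
  rw [hf u hux hu0] at hfu
  have h0 := eq_zero_of_height_eq_zero
    (mem_cone_iff.2 fun i => by rw [hu]; exact abs_nonneg _) hfu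
  apply Δ.repr.injective
  ext i
  have := hu i
  rw [h0, map_zero, Finsupp.zero_apply] at this
  rw [map_zero, Finsupp.zero_apply, abs_eq_zero.1 this.symm]

theorem IsConeRadical.mem_anisotropicRoots {x : V} (hx : IsConeRadical B Δ x)
    (hΔ : IsSimpleSystem B Δ) {f : V →ₗ[ℝ] ℝ}
    (hf : ∀ r ∈ suppSpan Δ x, B r r = 0 → f r = height Δ r)
    (hpos : ∀ i, Δ.repr x i ≠ 0 → 0 ≤ f (Δ i)) {u : V} (hu : u ∈ roots B Δ)
    (hux : u ∈ suppSpan Δ x) (hfu : f u = 0) : u ∈ anisotropicRoots B Δ := by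
  refine ⟨hu, {i | Δ.repr x i ≠ 0 ∧ f (Δ i) = 0}, fun v => hx.eq_zero_of_isotropic hΔ hf, ?_⟩
  have key : ∀ σ ∈ posRoots B Δ, σ ∈ suppSpan Δ x → f σ = 0 →
      σ ∈ supported Δ {i | Δ.repr x i ≠ 0 ∧ f (Δ i) = 0} := by
    intro σ hσ hσx hfσ i hi
    by_cases hxi : Δ.repr x i = 0
    · exact hσx i (by simpa using hxi)
    rw [linear_expand (Δ := Δ) f σ, Finset.sum_eq_zero_iff_of_nonneg] at hfσ
    · exact (mul_eq_zero.1 (hfσ i (Finset.mem_univ i))).resolve_right fun h => hi ⟨hxi, h⟩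
    · intro j _
      by_cases hj : Δ.repr x j = 0
      · rw [hσx j (by simpa using hj), zero_smul]
      · exact mul_nonneg (mem_cone_iff.1 hσ.2 j) (hpos j hj)
  rcases mem_or_neg_mem_posRoots hΔ hu with h | h
  · exact key u h hux hfu
  · have := key _ h (neg_mem hux) (by rw [map_neg, hfu, neg_zero])
    rwa [neg_mem_iff] at this

/-- Move `f` into the fundamental chamber of the support: composing with s_i for a simple root where
`f` is negative shrinks the finite set of positive roots with `f` negative. Agreement with the
height on isotropic vectors survives because these are orthogonal to the whole support span, and
B(u, v) is invariant. -/
theorem IsConeRadical.exists_anisotropicRoots {x : V} (hx : IsConeRadical B Δ x)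
    (hΔ : IsSimpleSystem B Δ) (n : ℕ) : ∀ f : V →ₗ[ℝ] ℝ,
    (∀ r ∈ suppSpan Δ x, B r r = 0 → f r = height Δ r) →
    {σ | σ ∈ posRoots B Δ ∧ σ ∈ suppSpan Δ x ∧ f σ < 0}.Finite →
    {σ | σ ∈ posRoots B Δ ∧ σ ∈ suppSpan Δ x ∧ f σ < 0}.ncard = n →
    ∀ u ∈ roots B Δ, u ∈ suppSpan Δ x → f u = 0 → ∀ v ∈ roots B Δ, v ∈ suppSpan Δ x → f v = 0 →
    ∃ u' ∈ anisotropicRoots B Δ, ∃ v' ∈ anisotropicRoots B Δ, B u' v' = B u v := by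
  induction n using Nat.strong_induction_on with
  | _ n ih =>
  intro f hf hfin hcard u hu hux hfu v hv hvx hfv
  by_cases hpos : ∀ i, Δ.repr x i ≠ 0 → 0 ≤ f (Δ i)
  · exact ⟨u, hx.mem_anisotropicRoots hΔ hf hpos hu hux hfu, v,
      hx.mem_anisotropicRoots hΔ hf hpos hv hvx hfv, rfl⟩
  push Not at hpos
  obtain ⟨i, hi, hneg⟩ := hpos
  have hs := reflection_mem_weylGroup (B := B) Δ i
  set f' : V →ₗ[ℝ] ℝ := f ∘ₗ (reflection B (Δ i)).toLinearMap
  have hf' : ∀ v, f' v = f (reflection B (Δ i) v) := fun _ => rfl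
  set N := {σ | σ ∈ posRoots B Δ ∧ σ ∈ suppSpan Δ x ∧ f σ < 0}
  -- s_i preserves positivity of every positive root except `Δ i`, which itself leaves the negative
  -- set.
  have hsub : {σ | σ ∈ posRoots B Δ ∧ σ ∈ suppSpan Δ x ∧ f' σ < 0} ⊆
      reflection B (Δ i) '' (N \ {Δ i}) := by
    rintro σ ⟨hσ, hσx, hfσ⟩
    rw [hf'] at hfσ
    have hne : σ ≠ Δ i := by
      rintro rfl
      rw [reflection_self (hΔ.diag i), map_neg] at hfσ
      linarith
    have hpos := reflection_simple_mem_posRoots hΔ hσ hne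
    refine ⟨reflection B (Δ i) σ, ⟨⟨hpos, reflection_mem_suppSpan hΔ hi hσx, hfσ⟩, ?_⟩,
      reflection_reflection _ _⟩
    intro h
    have h2 : σ = -Δ i := by
      rw [← reflection_self (hΔ.diag i)]
      nth_rw 2 [← Set.mem_singleton_iff.1 h]
      rw [reflection_reflection]
    have h3 := height_pos hΔ hσ
    rw [h2, map_neg, height_simple] at h3
    linarith
  have hfin' : (reflection B (Δ i) '' (N \ {Δ i})).Finite := (hfin.sdiff).image _
  have hlt : {σ | σ ∈ posRoots B Δ ∧ σ ∈ suppSpan Δ x ∧ f' σ < 0}.ncard < n := by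
    calc _ ≤ (reflection B (Δ i) '' (N \ {Δ i})).ncard := Set.ncard_le_ncard hsub hfin'
      _ ≤ (N \ {Δ i}).ncard := Set.ncard_image_le hfin.sdiff
      _ < N.ncard := Set.ncard_sdiff_singleton_lt_of_mem
        ⟨simple_mem_posRoots i, simple_mem_supported hi, hneg⟩ hfin
      _ = n := hcard
  have hfr : ∀ r ∈ suppSpan Δ x, B r r = 0 → f' r = height Δ r := by
    intro r hr hr0
    rw [hf', reflection_apply_of_unit (hΔ.diag i),
      hx.bilin_eq_zero_of_isotropic hΔ (simple_mem_supported hi) hr hr0, mul_zero, zero_smul,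
      sub_zero, hf r hr hr0]
  obtain ⟨u', hu', v', hv', h⟩ := ih _ hlt f' hfr (hfin'.subset hsub) rfl
    (reflection B (Δ i) u) (apply_mem_roots hs hu) (reflection_mem_suppSpan hΔ hi hux)
    (by rw [hf', reflection_reflection, hfu]) (reflection B (Δ i) v) (apply_mem_roots hs hv)
    (reflection_mem_suppSpan hΔ hi hvx) (by rw [hf', reflection_reflection, hfv])
  exact ⟨u', hu', v', hv', by rw [h, reflection_isometry hΔ.symm (hΔ.diag i)]⟩

/-- A finite set that contains the values of `B` on a simple root and a root in the support of a cone
radical vector. -/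
def bilinValues (B : LinearMap.BilinForm ℝ V) (Δ : Module.Basis ι ℝ V) : Set ℝ :=
  {0, 1, -1} ∪ Set.image2 (fun u v => B u v) (anisotropicRoots B Δ) (anisotropicRoots B Δ)

theorem finite_bilinValues (hΔ : IsSimpleSystem B Δ) : (bilinValues B Δ).Finite :=
  (Set.toFinite _).union
    ((finite_anisotropicRoots hΔ).image2 _ (finite_anisotropicRoots hΔ))

theorem IsConeRadical.bilin_mem_bilinValues {x : V} (hx : IsConeRadical B Δ x)
    (hΔ : IsSimpleSystem B Δ) {ρ : V} (hρ : ρ ∈ roots B Δ) (hρx : ρ ∈ suppSpan Δ x) (i : ι) :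
    B ρ (Δ i) ∈ bilinValues B Δ := by
  by_cases hi : Δ.repr x i = 0
  · rw [hx.bilin_simple_eq_zero hΔ hρx hi]
    exact Or.inl (Or.inl rfl)
  have hα := simple_mem_roots (B := B) Δ i
  have hαx : Δ i ∈ suppSpan Δ x := simple_mem_supported hi
  have habs := hx.abs_bilin_le_one hΔ hρ hα hρx hαx
  set c := B ρ (Δ i) with hcdef
  by_cases hc1 : c = 1
  · exact Or.inl (Or.inr (Or.inl hc1))
  by_cases hc2 : c = -1
  · exact Or.inl (Or.inr (Or.inr hc2))
  have hc : 1 - c ^ 2 ≠ 0 := by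
    intro h
    rcases sq_eq_sq_iff_eq_or_eq_neg.1 (by linarith : c ^ 2 = 1 ^ 2) with h | h
    exacts [hc1 h, hc2 h]
  -- `a` and `b` solve B(p, ρ) = height ρ and B(p, Δ i) = height (Δ i), a Gram system of determinant
  -- 1 − c². Thus height − B(p, ·) vanishes on both roots.
  set a := (height Δ ρ - c * height Δ (Δ i)) / (1 - c ^ 2)
  set b := (height Δ (Δ i) - c * height Δ ρ) / (1 - c ^ 2)
  set p := a • ρ + b • Δ i with hp
  have hpx : p ∈ suppSpan Δ x :=
    add_mem (Submodule.smul_mem _ _ hρx) (Submodule.smul_mem _ _ hαx)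
  have hBp : ∀ v, B p v = a * B ρ v + b * B (Δ i) v := fun v => by
    simp [hp]
  -- B(p, ·) is bounded by |a| + |b| on roots of the support, so negativity bounds the height.
  have hfin : {σ | σ ∈ posRoots B Δ ∧ σ ∈ suppSpan Δ x ∧ (height Δ - B p) σ < 0}.Finite := by
    refine (finite_posRoots_height_le hΔ (|a| + |b|)).subset ?_
    rintro σ ⟨hσ, hσx, h⟩
    refine ⟨hσ, ?_⟩
    rw [LinearMap.sub_apply, hBp] at h
    have h1 : a * B ρ σ ≤ |a| := by
      refine (le_abs_self _).trans ?_
      rw [abs_mul]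
      exact mul_le_of_le_one_right (abs_nonneg _) (hx.abs_bilin_le_one hΔ hρ hσ.1 hρx hσx)
    have h2 : b * B (Δ i) σ ≤ |b| := by
      refine (le_abs_self _).trans ?_
      rw [abs_mul]
      exact mul_le_of_le_one_right (abs_nonneg _) (hx.abs_bilin_le_one hΔ hα hσ.1 hαx hσx)
    linarith
  obtain ⟨u, hu, v, hv, h⟩ := hx.exists_anisotropicRoots hΔ _ (height Δ - B p) (fun r hr hr0 => by
      rw [LinearMap.sub_apply, hx.bilin_eq_zero_of_isotropic hΔ hpx hr hr0, sub_zero]) hfin rfl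
    ρ hρ hρx (by
      rw [LinearMap.sub_apply, hBp, root_unit hΔ hρ, hΔ.symm (Δ i) ρ, ← hcdef]
      simp only [a, b]
      field_simp
      ring)
    (Δ i) hα hαx (by
      rw [LinearMap.sub_apply, hBp, hΔ.diag, ← hcdef]
      simp only [a, b]
      field_simp
      ring)
  exact Or.inr ⟨u, hu, v, hv, h⟩

/-! ### Density at limit roots in the radical -/

theorem mem_closure_of_forall_bilin_eq_zero (hΔ : IsSimpleSystem B Δ) {x : V}
    (hx : x ∈ limitRoots B Δ) (hrad : ∀ i, B (Δ i) x = 0) :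
    x ∈ closure (isotropicLinePoints B Δ) := by
  obtain ⟨hxB, hx1⟩ := limitRoots_subset hΔ hx
  rw [coordSum_eq_height] at hx1
  have hfreq := frequently_posRoots_of_mem_limitRoots hΔ hx
  have hrepr : ∀ i, Continuous fun v => Δ.repr v i := fun i => continuous_linear Δ (Δ.coord i)
  have hxc : IsConeRadical B Δ x := by
    refine ⟨fun i => ?_, hrad⟩
    have hcl : IsClosed {v : V | 0 ≤ Δ.repr v i} := isClosed_le continuous_const (hrepr i)
    refine hcl.mem_of_frequently_of_tendsto (hfreq.mono ?_) tendsto_id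
    rintro _ ⟨ρ, hρ, rfl⟩
    have h1 := height_pos hΔ hρ
    have h2 := mem_cone_iff.1 hρ.2 i
    change 0 ≤ Δ.repr (normalizeVec Δ ρ) i
    rw [normalizeVec_eq, map_smul, Finsupp.smul_apply, smul_eq_mul]
    positivity
  obtain ⟨i, hi⟩ : ∃ i, Δ.repr x i ≠ 0 := by
    by_contra! h
    rw [height_apply, Finset.sum_eq_zero fun i _ => h i] at hx1
    exact zero_ne_one hx1
  have hfreq2 : ∃ᶠ v in 𝓝 x, ∃ k ∈ Set.univ.pi fun _ : ι => bilinValues B Δ,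
      ∃ ρ ∈ posRoots B Δ, (∀ j, B ρ (Δ j) = k j) ∧ normalizeVec Δ ρ = v := by
    have hev : ∀ᶠ v in 𝓝 x, Δ.repr v i ≠ 0 := (hrepr i).continuousAt.eventually_ne hi
    refine (hfreq.and_eventually hev).mono ?_
    rintro _ ⟨⟨ρ, hρ, rfl⟩, hne⟩
    -- A root lies wholly inside or outside the support; its nonzero `i`-th coordinate puts it
    -- inside.
    have hρx : ρ ∈ suppSpan Δ x := by
      refine (hxc.mem_supported_of_root hΔ hρ.1).resolve_right fun h => hne ?_
      rw [normalizeVec_eq, map_smul, Finsupp.smul_apply, h i hi, smul_zero]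
    exact ⟨fun j => B ρ (Δ j), fun j _ => hxc.bilin_mem_bilinValues hΔ hρ.1 hρx j, ρ, hρ,
      fun _ => rfl, rfl⟩
  -- Pigeonhole over the finitely many possible vectors of values on the simple roots.
  obtain ⟨k, hk⟩ : ∃ k : ι → ℝ, ∃ᶠ v in 𝓝 x,
      ∃ ρ ∈ posRoots B Δ, (∀ j, B ρ (Δ j) = k j) ∧ normalizeVec Δ ρ = v := by
    by_contra hcon
    rw [not_exists] at hcon
    refine hfreq2 (((eventually_all_finite (Set.Finite.pi' fun _ : ι => finite_bilinValues hΔ)).2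
      fun k _ => not_frequently.1 (hcon k)).mono ?_)
    rintro v hv ⟨k, hk, h⟩
    exact hv k (fun j => hk j trivial) h
  obtain ⟨-, η, hη, hηk, -⟩ := hk.exists
  -- For v = ρ̂ the square root is the inverse height of ρ, so the perturbed vector is a multiple of
  -- ρ − η, which is in the radical.
  refine mem_closure_of_frequently hΔ hx1 hη (s := fun v => -√(B v v))
    (continuous_bilin_self B Δ).sqrt.neg.continuousAt (by simp [hxB]) ?_
  refine (hk.and_eventually (eventually_ne_normalizeVec hΔ hxB hη.1)).mono ?_
  rintro _ ⟨⟨ρ, hρ, hρk, rfl⟩, hne⟩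
  refine ⟨ρ, hρ, ?_, rfl, ?_⟩
  · rintro rfl
    exact hne rfl
  have h0 : B (ρ - η) (ρ - η) = 0 := by
    rw [bilin_expand_left (Δ := Δ)]
    refine Finset.sum_eq_zero fun j _ => ?_
    rw [hΔ.symm, map_sub B, LinearMap.sub_apply, hρk, hηk, sub_self, mul_zero]
  have h1 : normalizeVec Δ ρ + -√(B (normalizeVec Δ ρ) (normalizeVec Δ ρ)) • η =
      (height Δ ρ)⁻¹ • (ρ - η) := by
    rw [bilin_normalizeVec hΔ hρ.1, Real.sqrt_sq (inv_nonneg.2 (height_pos hΔ hρ).le),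
      normalizeVec_eq]
    module
  simp only [h1, map_smul, LinearMap.smul_apply, h0, smul_zero]

theorem limitRoots_subset_closure (hΔ : IsSimpleSystem B Δ) :
    limitRoots B Δ ⊆ closure (isotropicLinePoints B Δ) := by
  intro x hx
  by_cases h : ∀ i, B (Δ i) x = 0
  · exact mem_closure_of_forall_bilin_eq_zero hΔ hx h
  · push Not at h
    obtain ⟨i, hi⟩ := h
    exact mem_closure_of_bilin_ne_zero hΔ hx hi

end Density

end BasedRoot

theorem mainTheorem3 {ι V : Type*} [Fintype ι] [NormedAddCommGroup V] [NormedSpace ℝ V]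
    (B : LinearMap.BilinForm ℝ V) (Δ : Module.Basis ι ℝ V)
    (hΔ : BasedRoot.IsSimpleSystem B Δ) (hΦ : (BasedRoot.roots B Δ).Infinite) :
    BasedRoot.dihedralLimitRoots B Δ = BasedRoot.isotropicLinePoints B Δ ∧
      BasedRoot.dihedralLimitRoots B Δ ⊆ BasedRoot.limitRoots B Δ ∧
      BasedRoot.limitRoots B Δ ⊆ closure (BasedRoot.dihedralLimitRoots B Δ) ∧
      BasedRoot.limitRoots B Δ = closure (BasedRoot.dihedralLimitRoots B Δ) := by
  have h1 := BasedRoot.dihedralLimitRoots_eq hΔ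
  have h2 : BasedRoot.dihedralLimitRoots B Δ ⊆ BasedRoot.limitRoots B Δ :=
    BasedRoot.dihedralLimitRoots_subset
  have h3 : BasedRoot.limitRoots B Δ ⊆ closure (BasedRoot.dihedralLimitRoots B Δ) := by
    rw [h1]
    exact BasedRoot.limitRoots_subset_closure hΔ
  exact ⟨h1, h2, h3, h3.antisymm (closure_minimal h2 (isClosed_derivedSet _))⟩
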